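/- **Setting.** Let $(Y_i,X_i,W_i)_{i\ge 1}$ be i.i.d. with values in $\mathbb R\times\mathcal X\times\mathcal W$, $\mathcal X\subseteq\mathbb R^d$, $\mathcal W\subseteq\mathbb R^{d_w}$, such that $Y_i=h_0(X_i)+u_i$ and $E[u_i\mid W_i]=0$, with $u_i$ integrable and $h_0\in L^2(X)$. Let $T:L^2(X)\to L^2(W)$ be the conditional expectation operator $Th(w)=E[h(X_i)\mid W_i=w]$. For all $J,K\ge 1$ let $\psi^J=(\psi_{J1},\dots,\psi_{JJ})'$ and $b^K=(b_{K1},\dots,b_{KK})'$ be vectors of measurable functions in $L^2(X)$ and $L^2(W)$, spanning $\Psi_J\subset L^2(X)$ and $B_K\subset L^2(W)$, and let $\Pi_J$ and $\Pi_K$ be the orthogonal projections of $L^2(X)$ onto $\Psi_J$ and of $L^2(W)$ onto $B_K$. The dimensions $J=J_n$ and $K=K_n$ are deterministic functions of $n$ with $J_n\le K_n=O(J_n)$ and $J_n\ge 2$ for all large $n$ (as holds when $J_n\to\infty$). Assume that $G_\psi=E[\psi^J(X_i)\psi^J(X_i)']$ and $G_b=E[b^K(W_i)b^K(W_i)']$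 are positive definite for $J=J_n$, $K=K_n$. Put $$\tau_J=\sup_{h\in\Psi_J,\,h\ne0}\frac{\|h\|_{L^2(X)}}{\|Th\|_{L^2(W)}},\qquad \zeta=\max\Big\{\sup_{w\in\mathcal W}\|G_b^{-1/2}b^K(w)\|_{\ell^2},\ \sup_{x\in\mathcal X}\|G_\psi^{-1/2}\psi^J(x)\|_{\ell^2}\Big\}.$$ With $\Psi=(\psi^J(X_1),\dots,\psi^J(X_n))'$, $B=(b^K(W_1),\dots,b^K(W_n))'$, $\mathbf Y=(Y_1,\dots,Y_n)'$, $H_0=(h_0(X_1),\dots,h_0(X_n))'$, and $A\mapsto A^-$ any choice of generalized inverse of square matrices ($AA^-A=A$), define $$\hat h(x)=\psi^J(x)'[\Psi'B(B'B)^-B'\Psi]^-\Psi'B(B'B)^-B'\mathbf Y,\qquad \tilde h(x)=\psi^J(x)'[\Psi'B(B'B)^-B'\Psi]^-\Psi'B(B'B)^-B'H_0 .$$ **Theorem 2.3.** Suppose that $T$ is injective and that, as $n\to\infty$ with $J=J_n$, $K=K_n$, (i) $\displaystyle\sup_{h\in\Psi_J,\ \|h\|_{L^2(X)}=1}\|(\Pi_KT-T)h\|_{L^2(W)}=o(\tau_J^{-1})$;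 (ii) $\tau_J\,\|T(h_0-\Pi_Jh_0)\|_{L^2(W)}\le C\,\|h_0-\Pi_Jh_0\|_{L^2(X)}$ for all $n$, with a finite constant $C$; (iii) $\tau_J\,\zeta\,\sqrt{(\log J)/n}=o(1)$. Then: (1) $\|\tilde h-h_0\|_{L^2(X)}\le O_p(1)\times\|h_0-\Pi_Jh_0\|_{L^2(X)}$. (2) If in addition $E[u_i^2\mid W_i]\le\bar\sigma^2<\infty$ almost surely for a constant $\bar\sigma$, then $$\|\hat h-h_0\|_{L^2(X)}=O_p\big(\|h_0-\Pi_Jh_0\|_{L^2(X)}+\tau_J\sqrt{J/n}\big).$$ Here, for a deterministic sequence $a_n\ge0$, both "$Z_n\le O_p(1)\times a_n$" and "$Z_n=O_p(a_n)$" mean: for every $\varepsilon>0$ there is $M<\infty$ with $P(Z_n>Ma_n)\le\varepsilon$ for all large $n$. -/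

import Mathlib

open MeasureTheory ProbabilityTheory Filter Topology Matrix
open scoped ENNReal NNReal

noncomputable section

namespace NPIV

section Probability

variable {Ω α β : Type*} [MeasurableSpace Ω] [MeasurableSpace α] [MeasurableSpace β]

/-- `Z n = O_p(a n)` for nonnegative (possibly infinite) random quantities `Z n` and
deterministic `a n`: for every `ε > 0` there is a finite `M` such that
`P (Z n > M * a n) ≤ ε` for all large `n`. -/
def IsBigOP (P : Measure Ω) (Z : ℕ → Ω → ℝ≥0∞) (a : ℕ → ℝ≥0∞) : Prop :=
  ∀ ε : ℝ≥0∞, 0 < ε → ∃ M : ℝ≥0, ∀ᶠ n in atTop, P {ω | (M : ℝ≥0∞) * a n < Z n ω} ≤ ε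

/-- `(Y i, X i, W i)`, `i = 0, 1, 2, …`, is a random sample (i.i.d.) from the model
`Y i = h₀ (X i) + u i`, `E[u i | W i] = 0`, with `h₀ ∈ L²(X)`. -/
structure IsNPIVSample (P : Measure Ω) (Y : ℕ → Ω → ℝ) (X : ℕ → Ω → α) (W : ℕ → Ω → β)
    (h₀ : α → ℝ) : Prop where
  measurable_Y : ∀ i, Measurable (Y i)
  measurable_X : ∀ i, Measurable (X i)
  measurable_W : ∀ i, Measurable (W i)
  indep : iIndepFun (fun i ω => (Y i ω, X i ω, W i ω)) P
  ident : ∀ i, IdentDistrib (fun ω => (Y i ω, X i ω, W i ω)) (fun ω => (Y 0 ω, X 0 ω, W 0 ω)) P P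
  measurable_h₀ : Measurable h₀
  memLp_h₀ : MemLp h₀ 2 (P.map (X 0))
  integrable_u : ∀ i, Integrable (fun ω => Y i ω - h₀ (X i ω)) P
  condExp_u : ∀ i,
    P[fun ω => Y i ω - h₀ (X i ω) | MeasurableSpace.comap (W i) inferInstance] =ᵐ[P] 0

/-- `E[u i ^ 2 | W i] ≤ σ²` almost surely, for a finite constant `σ`. -/
def BoundedCondVariance (P : Measure Ω) (Y : ℕ → Ω → ℝ) (X : ℕ → Ω → α) (W : ℕ → Ω → β)
    (h₀ : α → ℝ) : Prop :=
  ∃ σ : ℝ, ∀ i, MemLp (fun ω => Y i ω - h₀ (X i ω)) 2 P ∧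
    P[fun ω => (Y i ω - h₀ (X i ω)) ^ 2 | MeasurableSpace.comap (W i) inferInstance]
      ≤ᵐ[P] fun _ => σ ^ 2

end Probability

section Operator

variable {Ω α β : Type*} [MeasurableSpace Ω] [MeasurableSpace α] [MeasurableSpace β]
  [StandardBorelSpace α] [Nonempty α]

/-- `w ↦ E[h(X) | W = w]`, through the regular conditional distribution of `X` given `W`. -/
def condExpFun (P : Measure Ω) [IsFiniteMeasure P] (X : Ω → α) (W : Ω → β) (h : α → ℝ) :
    β → ℝ :=
  fun w => ∫ x, h x ∂(condDistrib X W P w)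

theorem memLp_condExpFun (P : Measure Ω) [IsFiniteMeasure P] {X : Ω → α} {W : Ω → β}
    (hX : Measurable X) (hW : Measurable W) {h : α → ℝ} (hh : MemLp h 2 (P.map X)) :
    MemLp (condExpFun P X W h) 2 (P.map W) := by
  have hXW : MeasurePreserving X P (P.map X) := ⟨hX, rfl⟩
  have hj : Measurable fun ω => (W ω, X ω) := hW.prodMk hX
  have hsnd : MeasurePreserving (Prod.snd : β × α → α) (P.map fun ω => (W ω, X ω)) (P.map X) :=
    ⟨measurable_snd, by rw [Measure.map_map measurable_snd hj]; rfl⟩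
  have hf : Integrable (fun p : β × α => h p.2) (P.map fun ω => (W ω, X ω)) :=
    (hh.comp_measurePreserving hsnd).integrable one_le_two
  have hmeas : AEStronglyMeasurable (condExpFun P X W h) (P.map W) :=
    AEStronglyMeasurable.integral_condDistrib_map hX.aemeasurable hf.1
  rw [memLp_map_measure_iff hmeas hW.aemeasurable]
  exact ((hh.comp_measurePreserving hXW).condExp one_le_two).ae_eq
    (condExp_prod_ae_eq_integral_condDistrib' hW hX.aemeasurable hf)

/-- The conditional expectation operator `T : L²(X) → L²(W)`, `T h (w) = E[h(X) | W = w]`. -/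
def condExpOp (P : Measure Ω) [IsFiniteMeasure P] {X : Ω → α} {W : Ω → β}
    (hX : Measurable X) (hW : Measurable W) (h : Lp ℝ 2 (P.map X)) : Lp ℝ 2 (P.map W) :=
  (memLp_condExpFun P hX hW (Lp.memLp h)).toLp (condExpFun P X W h)

end Operator

section Sieve

variable {α : Type*} [MeasurableSpace α] {J : ℕ}

/-- The linear sieve space spanned in `L²(μ)` by the basis functions `ψ j`. -/
def sieveSpace {μ : Measure α} (ψ : Fin J → α → ℝ) (hψ : ∀ j, MemLp (ψ j) 2 μ) :
    Submodule ℝ (Lp ℝ 2 μ) :=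
  Submodule.span ℝ (Set.range fun j => (hψ j).toLp (ψ j))

instance {μ : Measure α} (ψ : Fin J → α → ℝ) (hψ : ∀ j, MemLp (ψ j) 2 μ) :
    FiniteDimensional ℝ (sieveSpace ψ hψ) :=
  FiniteDimensional.span_of_finite ℝ (Set.finite_range _)

/-- The Gram matrix `E[ψ(X) ψ(X)']`, where `μ` is the law of `X`. -/
def gram (μ : Measure α) (ψ : Fin J → α → ℝ) : Matrix (Fin J) (Fin J) ℝ :=
  Matrix.of fun j k => ∫ x, ψ j x * ψ k x ∂μ

/-- `G^{-1/2}` for a positive definite matrix `G`, by the functional calculus. -/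
def invSqrt (G : Matrix (Fin J) (Fin J) ℝ) : Matrix (Fin J) (Fin J) ℝ :=
  cfc (fun t : ℝ => (√t)⁻¹) G

/-- `sup_{x ∈ s} ‖G^{-1/2} ψ(x)‖` with the Euclidean norm and `G = E[ψ(X) ψ(X)']`. -/
def zeta (μ : Measure α) (s : Set α) (ψ : Fin J → α → ℝ) : ℝ≥0∞ :=
  ⨆ x ∈ s, ‖WithLp.toLp 2 (invSqrt (gram μ ψ) *ᵥ fun j => ψ j x)‖ₑ

/-- The sieve measure of ill-posedness `sup_{h ∈ V, h ≠ 0} ‖h‖ / ‖T h‖`. -/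
def illPosedness {E F : Type*} [NormedAddCommGroup E] [NormedSpace ℝ E] [NormedAddCommGroup F]
    (T : E → F) (V : Submodule ℝ E) : ℝ≥0∞ :=
  ⨆ h ∈ V, ⨆ _ : h ≠ 0, ‖h‖ₑ / ‖T h‖ₑ

/-- `sup_{h ∈ V, ‖h‖ = 1} ‖(Π_U T - T) h‖`, with `Π_U` the orthogonal projection onto `U`. -/
def projectionGap {E F : Type*} [NormedAddCommGroup E] [NormedSpace ℝ E]
    [NormedAddCommGroup F] [InnerProductSpace ℝ F]
    (T : E → F) (V : Submodule ℝ E) (U : Submodule ℝ F) [U.HasOrthogonalProjection] : ℝ≥0∞ :=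
  ⨆ h ∈ V, ⨆ _ : ‖h‖ = 1, ‖U.starProjection (T h) - T h‖ₑ

end Sieve

section Estimator

variable {Ω α β : Type*}

/-- A choice of generalized inverse `A ↦ A⁻` of square real matrices: `A A⁻ A = A`. -/
def IsGeneralizedInverse
    (ginv : (k : ℕ) → Matrix (Fin k) (Fin k) ℝ → Matrix (Fin k) (Fin k) ℝ) : Prop :=
  ∀ (k : ℕ) (A : Matrix (Fin k) (Fin k) ℝ), A * ginv k A * A = A

/-- The `n × J` matrix with rows `ψ(X₁)', …, ψ(Xₙ)'`. -/
def design (n : ℕ) {J : ℕ} (ψ : Fin J → α → ℝ) (X : ℕ → Ω → α) (ω : Ω) :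
    Matrix (Fin n) (Fin J) ℝ :=
  Matrix.of fun i j => ψ j (X i ω)

/-- The two-stage least squares coefficient vector
`[Ψ'B(B'B)⁻B'Ψ]⁻ Ψ'B(B'B)⁻B' y`. -/
def tslsCoef (ginv : (k : ℕ) → Matrix (Fin k) (Fin k) ℝ → Matrix (Fin k) (Fin k) ℝ)
    {n J K : ℕ} (Ψ : Matrix (Fin n) (Fin J) ℝ) (B : Matrix (Fin n) (Fin K) ℝ) (y : Fin n → ℝ) :
    Fin J → ℝ :=
  (ginv J (Ψᵀ * B * ginv K (Bᵀ * B) * Bᵀ * Ψ) * (Ψᵀ * B * ginv K (Bᵀ * B) * Bᵀ)) *ᵥ y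

/-- The series two-stage least squares fit, as a function on `α`, of the responses
`Z 1, …, Z n` on the regressor basis `ψ` with the instrument basis `b`.
The sieve NPIV estimator is the case `Z i = Y i`; the case `Z i = h₀ (X i)` is its noiseless
counterpart. -/
def sieveFit (ginv : (k : ℕ) → Matrix (Fin k) (Fin k) ℝ → Matrix (Fin k) (Fin k) ℝ)
    (n : ℕ) {J K : ℕ} (ψ : Fin J → α → ℝ) (b : Fin K → β → ℝ)
    (Z : ℕ → Ω → ℝ) (X : ℕ → Ω → α) (W : ℕ → Ω → β) (ω : Ω) : α → ℝ :=
  fun x => ∑ j, ψ j x * tslsCoef ginv (design n ψ X ω) (design n b W ω) (fun i => Z i ω) j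

end Estimator

/-- The sieve NPIV setting: a random sample from the model, the supports (or any sets that contain
the data almost surely), basis functions `ψ^J = (ψ_{J1}, …, ψ_{JJ})` in `L²(X)` and
`b^K = (b_{K1}, …, b_{KK})` in `L²(W)` with positive definite Gram matrices, deterministic sieve
dimensions `J n ≤ K n = O(J n)` for the sample size `n`, and the generalized inverse used by the
estimator. -/
structure Setting {Ω : Type*} [MeasurableSpace Ω] (P : Measure Ω) (d dw : ℕ) where
  Y : ℕ → Ω → ℝ
  X : ℕ → Ω → EuclideanSpace ℝ (Fin d)
  W : ℕ → Ω → EuclideanSpace ℝ (Fin dw)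
  h₀ : EuclideanSpace ℝ (Fin d) → ℝ
  sample : IsNPIVSample P Y X W h₀
  suppX : Set (EuclideanSpace ℝ (Fin d))
  suppW : Set (EuclideanSpace ℝ (Fin dw))
  mem_suppX : ∀ i, ∀ᵐ ω ∂P, X i ω ∈ suppX
  mem_suppW : ∀ i, ∀ᵐ ω ∂P, W i ω ∈ suppW
  ψ : (J : ℕ) → Fin J → EuclideanSpace ℝ (Fin d) → ℝ
  b : (K : ℕ) → Fin K → EuclideanSpace ℝ (Fin dw) → ℝ
  measurable_ψ : ∀ J j, Measurable (ψ J j)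
  measurable_b : ∀ K k, Measurable (b K k)
  memLp_ψ : ∀ J j, MemLp (ψ J j) 2 (P.map (X 0))
  memLp_b : ∀ K k, MemLp (b K k) 2 (P.map (W 0))
  J : ℕ → ℕ
  K : ℕ → ℕ
  eventually_two_le_J : ∀ᶠ n in atTop, 2 ≤ J n
  J_le_K : ∀ n, J n ≤ K n
  K_isBigO : (fun n => (K n : ℝ)) =O[atTop] fun n => (J n : ℝ)
  gram_ψ_posDef : ∀ n, (gram (P.map (X 0)) (ψ (J n))).PosDef
  gram_b_posDef : ∀ n, (gram (P.map (W 0)) (b (K n))).PosDef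
  ginv : (k : ℕ) → Matrix (Fin k) (Fin k) ℝ → Matrix (Fin k) (Fin k) ℝ
  isGeneralizedInverse : IsGeneralizedInverse ginv

namespace Setting

variable {Ω : Type*} [MeasurableSpace Ω] {P : Measure Ω} {d dw : ℕ} (M : Setting P d dw)

/-- The law of `X`; `Lp ℝ 2 M.lawX` is `L²(X)`. -/
abbrev lawX : Measure (EuclideanSpace ℝ (Fin d)) := P.map (M.X 0)

/-- The law of `W`; `Lp ℝ 2 M.lawW` is `L²(W)`. -/
abbrev lawW : Measure (EuclideanSpace ℝ (Fin dw)) := P.map (M.W 0)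

/-- The conditional expectation operator `T : L²(X) → L²(W)`. -/
def T [IsFiniteMeasure P] : Lp ℝ 2 M.lawX → Lp ℝ 2 M.lawW :=
  condExpOp P (M.sample.measurable_X 0) (M.sample.measurable_W 0)

/-- `Ψ_J` for `J = J n`. -/
def sieveX (n : ℕ) : Submodule ℝ (Lp ℝ 2 M.lawX) := sieveSpace (M.ψ (M.J n)) (M.memLp_ψ (M.J n))

/-- `B_K` for `K = K n`. -/
def sieveW (n : ℕ) : Submodule ℝ (Lp ℝ 2 M.lawW) := sieveSpace (M.b (M.K n)) (M.memLp_b (M.K n))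

instance (n : ℕ) : FiniteDimensional ℝ (M.sieveX n) :=
  inferInstanceAs (FiniteDimensional ℝ (sieveSpace (M.ψ (M.J n)) (M.memLp_ψ (M.J n))))

instance (n : ℕ) : FiniteDimensional ℝ (M.sieveW n) :=
  inferInstanceAs (FiniteDimensional ℝ (sieveSpace (M.b (M.K n)) (M.memLp_b (M.K n))))

/-- `h₀` as an element of `L²(X)`. -/
def h₀L : Lp ℝ 2 M.lawX := M.sample.memLp_h₀.toLp M.h₀

/-- `h₀ - Π_J h₀` in `L²(X)` for `J = J n`, with `Π_J` the orthogonal projection onto `Ψ_J`. -/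
def approxError (n : ℕ) : Lp ℝ 2 M.lawX := M.h₀L - (M.sieveX n).starProjection M.h₀L

/-- `τ_J` for `J = J n`. -/
def tau [IsFiniteMeasure P] (n : ℕ) : ℝ≥0∞ := illPosedness M.T (M.sieveX n)

/-- `ζ = ζ_{b,K} ∨ ζ_{ψ,J}` for `J = J n` and `K = K n`. -/
def zetaMax (n : ℕ) : ℝ≥0∞ :=
  max (zeta M.lawW M.suppW (M.b (M.K n))) (zeta M.lawX M.suppX (M.ψ (M.J n)))

/-- The sieve NPIV estimator of `h₀` from the first `n` observations. -/
def hHat (n : ℕ) (ω : Ω) : EuclideanSpace ℝ (Fin d) → ℝ :=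
  sieveFit M.ginv n (M.ψ (M.J n)) (M.b (M.K n)) M.Y M.X M.W ω

/-- The noiseless counterpart of the estimator, with `h₀ (X i)` in place of `Y i`. -/
def hTilde (n : ℕ) (ω : Ω) : EuclideanSpace ℝ (Fin d) → ℝ :=
  sieveFit M.ginv n (M.ψ (M.J n)) (M.b (M.K n)) (fun i ω => M.h₀ (M.X i ω)) M.X M.W ω

end Setting

end NPIV

end

/-!
Orthonormalize both bases, and stack the instruments and the regressors into one vector `φ`. The
empirical second moment matrix of `φ` deviates from its mean by at most `1 / (8 τ_J)` in operator
norm with probability tending to one. This follows from a bound on the traces of the even powers of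
the deviation, obtained by exchanging one observation with an independent copy; taking a power of
order `log (J + K)` costs exactly the factor `log J` of condition (iii).

On that event the sample analogue of the first stage is bounded below by a multiple of `1 / τ_J`
because, by (i), the population first stage is. The error of the coefficients, relative to those of
`Π_J h₀`, is then at most `4 τ_J` times the norm of the sample mean of the instruments multiplied by
the part of the regressand that `Π_J h₀` does not explain. For the residual `h₀ - Π_J h₀` the
expectation of this mean is `Π_K T (h₀ - Π_J h₀)` in orthonormal coordinates, which (ii) controls,
and its fluctuation is of order `ζ ‖h₀ - Π_J h₀‖ / √n`, where `τ_J ζ / √n` is bounded by (iii). For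
the noise the expectation is zero and the variance is at most `σ² K / n`. Markov's inequality
concludes.
-/

noncomputable section

open WithLp (toLp)
open scoped Matrix.Norms.L2Operator

namespace NPIV

section MatrixTrace

variable {ι : Type*} [Fintype ι]

open scoped MatrixOrder in
theorem exists_eq_conjTranspose_mul_self {A : Matrix ι ι ℝ} (hA : A.PosSemidef) :
    ∃ C : Matrix ι ι ℝ, A = Cᴴ * C := by
  classical exact CStarAlgebra.nonneg_iff_eq_star_mul_self.1 hA.nonneg

theorem trace_mul_nonneg {A B : Matrix ι ι ℝ} (hA : A.PosSemidef) (hB : B.PosSemidef) :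
    0 ≤ (A * B).trace := by
  obtain ⟨C, rfl⟩ := exists_eq_conjTranspose_mul_self hA
  rw [Matrix.mul_assoc, trace_mul_comm]
  exact (hB.mul_mul_conjTranspose_same C).trace_nonneg

theorem trace_sub_mul_mul_sub_le {A B P : Matrix ι ι ℝ} (hA : A.IsHermitian) (hB : B.IsHermitian)
    (hP : P.PosSemidef) :
    ((A - B) * P * (A - B)).trace ≤ 2 * ((A * P * A).trace + (B * P * B).trace) := by
  have parallelogram : ((A - B) * P * (A - B)).trace + ((A + B) * P * (A + B)).trace =
      2 * ((A * P * A).trace + (B * P * B).trace) := by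
    simp only [sub_mul, mul_sub, add_mul, mul_add, trace_sub, trace_add]
    ring
  have := (hP.mul_mul_conjTranspose_same (A + B)).trace_nonneg
  rw [(hA.add hB).eq] at this
  linarith

variable [DecidableEq ι]

theorem exists_joint_spectral_weights {X Y : Matrix ι ι ℝ} (hX : X.IsHermitian)
    (hY : Y.IsHermitian) :
    ∃ (x y : ι → ℝ) (w : ι → ι → ℝ), (∀ i j, 0 ≤ w i j) ∧
      ∀ a b : ℕ, (X ^ a * Y ^ b).trace = ∑ i, ∑ j, w i j * (x i ^ a * y j ^ b) := by
  set U := hX.eigenvectorUnitary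
  set V := hY.eigenvectorUnitary
  set E : Matrix ι ι ℝ := (U : Matrix ι ι ℝ)ᴴ * V with hE
  have spectral_pow {Z : Matrix ι ι ℝ} (hZ : Z.IsHermitian) (a : ℕ) :
      Z ^ a = (hZ.eigenvectorUnitary : Matrix ι ι ℝ) * diagonal (hZ.eigenvalues ^ a) *
        (hZ.eigenvectorUnitary : Matrix ι ι ℝ)ᴴ := by
    conv_lhs => rw [hZ.spectral_theorem, ← map_pow, diagonal_pow, Unitary.conjStarAlgAut_apply]
    rfl
  refine ⟨hX.eigenvalues, hY.eigenvalues, fun i j => E i j ^ 2, fun i j => sq_nonneg _,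
    fun a b => ?_⟩
  calc (X ^ a * Y ^ b).trace
      = (diagonal (hX.eigenvalues ^ a) * E * (diagonal (hY.eigenvalues ^ b) * Eᴴ)).trace := by
        rw [spectral_pow hX, spectral_pow hY, Matrix.mul_assoc, Matrix.mul_assoc,
          trace_mul_comm, hE, conjTranspose_mul, conjTranspose_conjTranspose]
        simp only [Matrix.mul_assoc, U, V]
    _ = ∑ i, ∑ j, E i j ^ 2 * (hX.eigenvalues i ^ a * hY.eigenvalues j ^ b) := by
        refine Finset.sum_congr rfl fun i _ => ?_
        rw [diag_apply, Matrix.mul_apply]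
        refine Finset.sum_congr rfl fun j _ => ?_
        rw [diagonal_mul, diagonal_mul, conjTranspose_apply, star_trivial, Pi.pow_apply,
          Pi.pow_apply]
        ring

theorem pow_mul_pow_add_pow_mul_pow_le (x y : ℝ) {q r n : ℕ} (h : q + r = n) (hn : Even n) :
    x ^ q * y ^ r + x ^ r * y ^ q ≤ x ^ n + y ^ n := by
  have similarly_ordered : 0 ≤ (|x| ^ q - |y| ^ q) * (|x| ^ r - |y| ^ r) := by
    rcases le_total |x| |y| with hxy | hxy
    · exact mul_nonneg_of_nonpos_of_nonpos
        (sub_nonpos.2 (pow_le_pow_left₀ (abs_nonneg _) hxy _))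
        (sub_nonpos.2 (pow_le_pow_left₀ (abs_nonneg _) hxy _))
    · exact mul_nonneg (sub_nonneg.2 (pow_le_pow_left₀ (abs_nonneg _) hxy _))
        (sub_nonneg.2 (pow_le_pow_left₀ (abs_nonneg _) hxy _))
  calc x ^ q * y ^ r + x ^ r * y ^ q ≤ |x ^ q * y ^ r| + |x ^ r * y ^ q| :=
        add_le_add (le_abs_self _) (le_abs_self _)
    _ = |x| ^ q * |y| ^ r + |x| ^ r * |y| ^ q := by simp only [abs_mul, abs_pow]
    _ ≤ |x| ^ n + |y| ^ n := by rw [← h, pow_add, pow_add]; linarith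
    _ = x ^ n + y ^ n := by rw [hn.pow_abs, hn.pow_abs]

theorem sub_mul_odd_pow_sub_le (x y : ℝ) (m : ℕ) :
    2 * ((x - y) * (x ^ (2 * m + 1) - y ^ (2 * m + 1))) ≤
      (2 * m + 1) * ((x - y) ^ 2 * (x ^ (2 * m) + y ^ (2 * m))) := by
  set S := ∑ i ∈ Finset.range (2 * m + 1), x ^ i * y ^ (2 * m - i) with hS
  have geom : S * (x - y) = x ^ (2 * m + 1) - y ^ (2 * m + 1) := by
    simpa using (Commute.all x y).geom_sum₂_mul (2 * m + 1)
  have reflect : S = ∑ i ∈ Finset.range (2 * m + 1), x ^ (2 * m - i) * y ^ i := by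
    rw [hS, ← Finset.sum_range_reflect]
    refine Finset.sum_congr rfl fun i hi => ?_
    have : i ≤ 2 * m := Nat.lt_succ_iff.1 (Finset.mem_range.1 hi)
    simp only [Nat.add_sub_cancel, Nat.sub_sub_self this]
  have bound : 2 * S ≤ (2 * m + 1) * (x ^ (2 * m) + y ^ (2 * m)) := by
    calc 2 * S = ∑ i ∈ Finset.range (2 * m + 1),
          (x ^ i * y ^ (2 * m - i) + x ^ (2 * m - i) * y ^ i) := by
          rw [Finset.sum_add_distrib, ← reflect, ← hS, two_mul]
      _ ≤ ∑ _i ∈ Finset.range (2 * m + 1), (x ^ (2 * m) + y ^ (2 * m)) := by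
          refine Finset.sum_le_sum fun i hi => ?_
          have hi : i + (2 * m - i) = 2 * m := by have := Finset.mem_range.1 hi; omega
          exact pow_mul_pow_add_pow_mul_pow_le x y hi (even_two_mul m)
      _ = _ := by rw [Finset.sum_const, Finset.card_range, nsmul_eq_mul]; push_cast; ring
  calc 2 * ((x - y) * (x ^ (2 * m + 1) - y ^ (2 * m + 1))) = (x - y) ^ 2 * (2 * S) := by
        rw [← geom]; ring
    _ ≤ _ := by linarith [mul_le_mul_of_nonneg_left bound (sq_nonneg (x - y))]

theorem trace_sub_mul_pow_mul_sub_add {R : Type*} [CommRing R] (X Y : Matrix ι ι R) (k : ℕ) :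
    ((X - Y) * X ^ k * (X - Y)).trace + ((X - Y) * Y ^ k * (X - Y)).trace =
      (X ^ (k + 2) * Y ^ 0).trace - 2 * (X ^ (k + 1) * Y ^ 1).trace + (X ^ k * Y ^ 2).trace +
        (X ^ 2 * Y ^ k).trace - 2 * (X ^ 1 * Y ^ (k + 1)).trace + (X ^ 0 * Y ^ (k + 2)).trace := by
  rw [trace_mul_comm _ (X - Y), trace_mul_comm _ (X - Y)]
  have e₁ : (Y * (X * X ^ k)).trace = (X ^ (k + 1) * Y ^ 1).trace := by
    rw [trace_mul_comm, pow_succ', pow_one]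
  have e₂ : (X * (Y * X ^ k)).trace = (X ^ (k + 1) * Y ^ 1).trace := by
    rw [← Matrix.mul_assoc, trace_mul_comm, ← Matrix.mul_assoc, ← pow_succ, pow_one]
  have e₃ : (Y * (Y * X ^ k)).trace = (X ^ k * Y ^ 2).trace := by
    rw [← Matrix.mul_assoc, trace_mul_comm, sq]
  have e₄ : (Y * (X * Y ^ k)).trace = (X ^ 1 * Y ^ (k + 1)).trace := by
    rw [trace_mul_comm, Matrix.mul_assoc, ← pow_succ, pow_one]
  simp only [sub_mul, mul_sub, trace_sub, e₁, e₂, e₃, e₄]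
  simp only [pow_succ', pow_zero, Matrix.mul_one, Matrix.one_mul, Matrix.mul_assoc]
  ring

theorem trace_sub_mul_odd_pow_sub_le {X Y : Matrix ι ι ℝ} (hX : X.IsHermitian)
    (hY : Y.IsHermitian) (m : ℕ) :
    2 * ((X - Y) * (X ^ (2 * m + 1) - Y ^ (2 * m + 1))).trace ≤
      (2 * m + 1) * (((X - Y) * X ^ (2 * m) * (X - Y)).trace +
        ((X - Y) * Y ^ (2 * m) * (X - Y)).trace) := by
  obtain ⟨x, y, w, hw, htr⟩ := exists_joint_spectral_weights hX hY
  have lhs : ((X - Y) * (X ^ (2 * m + 1) - Y ^ (2 * m + 1))).trace =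
      ∑ i, ∑ j, w i j * ((x i - y j) * (x i ^ (2 * m + 1) - y j ^ (2 * m + 1))) := by
    have expand : ((X - Y) * (X ^ (2 * m + 1) - Y ^ (2 * m + 1))).trace =
        (X ^ (2 * m + 2) * Y ^ 0).trace - (X ^ 1 * Y ^ (2 * m + 1)).trace -
          (X ^ (2 * m + 1) * Y ^ 1).trace + (X ^ 0 * Y ^ (2 * m + 2)).trace := by
      rw [trace_mul_comm (X ^ (2 * m + 1)) (Y ^ 1)]
      simp only [pow_succ', pow_zero, Matrix.mul_one, Matrix.one_mul, sub_mul, mul_sub, trace_sub]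
      ring
    rw [expand]
    simp only [htr, ← Finset.sum_sub_distrib, ← Finset.sum_add_distrib]
    exact Finset.sum_congr rfl fun i _ => Finset.sum_congr rfl fun j _ => by ring
  have rhs : ((X - Y) * X ^ (2 * m) * (X - Y)).trace + ((X - Y) * Y ^ (2 * m) * (X - Y)).trace =
      ∑ i, ∑ j, w i j * ((x i - y j) ^ 2 * (x i ^ (2 * m) + y j ^ (2 * m))) := by
    rw [trace_sub_mul_pow_mul_sub_add]
    simp only [htr, Finset.mul_sum, ← Finset.sum_sub_distrib, ← Finset.sum_add_distrib]
    exact Finset.sum_congr rfl fun i _ => Finset.sum_congr rfl fun j _ => by ring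
  rw [lhs, rhs]
  simp only [Finset.mul_sum]
  refine Finset.sum_le_sum fun i _ => Finset.sum_le_sum fun j _ => ?_
  linarith [mul_le_mul_of_nonneg_left (sub_mul_odd_pow_sub_le (x i) (y j) m) (hw i j)]

theorem two_mul_mul_trace_odd_pow_le {X : Matrix ι ι ℝ} (hX : X.IsHermitian) (t : ℝ) (m : ℕ) :
    2 * t * (X ^ (2 * m + 1)).trace ≤
      (X ^ (2 * m + 2)).trace + t ^ 2 * (X ^ (2 * m)).trace := by
  obtain ⟨x, y, w, hw, htr⟩ := exists_joint_spectral_weights hX hX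
  have trace_pow (a : ℕ) : (X ^ a).trace = ∑ i, ∑ j, w i j * x i ^ a := by
    simpa using htr a 0
  simp only [trace_pow, Finset.mul_sum, ← Finset.sum_add_distrib]
  refine Finset.sum_le_sum fun i _ => Finset.sum_le_sum fun j _ => ?_
  have : 0 ≤ w i j * ((x i ^ m) ^ 2 * (x i - t) ^ 2) := mul_nonneg (hw i j) (by positivity)
  linarith [show w i j * ((x i ^ m) ^ 2 * (x i - t) ^ 2) = w i j * x i ^ (2 * m + 2) +
    t ^ 2 * (w i j * x i ^ (2 * m)) - 2 * t * (w i j * x i ^ (2 * m + 1)) by ring]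

theorem posSemidef_even_pow {X : Matrix ι ι ℝ} (hX : X.IsHermitian) (m : ℕ) :
    (X ^ (2 * m)).PosSemidef := by
  rw [two_mul, pow_add]
  nth_rewrite 1 [← (hX.pow m).eq]
  exact posSemidef_conjTranspose_mul_self _

theorem posSemidef_smul_one_sub {A : Matrix ι ι ℝ} (hA : A.IsHermitian) {r : ℝ} (hr : ‖A‖ ≤ r) :
    (r • (1 : Matrix ι ι ℝ) - A).PosSemidef := by
  refine .of_dotProduct_mulVec_nonneg
    ((isHermitian_one.smul (IsSelfAdjoint.all r)).sub hA) fun x => ?_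
  have cauchy_schwarz : x ⬝ᵥ A *ᵥ x ≤ r * (x ⬝ᵥ x) :=
    calc x ⬝ᵥ A *ᵥ x = inner ℝ (toLp 2 (A *ᵥ x)) (toLp 2 x) := by
          rw [EuclideanSpace.inner_toLp_toLp, star_trivial]
      _ ≤ ‖toLp 2 (A *ᵥ x)‖ * ‖toLp 2 x‖ := real_inner_le_norm _ _
      _ ≤ r * ‖toLp 2 x‖ * ‖toLp 2 x‖ := by
          gcongr
          exact (A.l2_opNorm_mulVec (toLp 2 x)).trans (by gcongr)
      _ = r * (x ⬝ᵥ x) := by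
          rw [mul_assoc, ← real_inner_self_eq_norm_mul_norm, EuclideanSpace.inner_toLp_toLp,
            star_trivial]
  rw [star_trivial, sub_mulVec, smul_mulVec, one_mulVec, dotProduct_sub, dotProduct_smul,
    smul_eq_mul]
  exact sub_nonneg.2 cauchy_schwarz

theorem trace_mul_le_norm_mul_trace {A P : Matrix ι ι ℝ} (hA : A.IsHermitian) (hP : P.PosSemidef)
    {r : ℝ} (hr : ‖A‖ ≤ r) : (A * P).trace ≤ r * P.trace := by
  have := trace_mul_nonneg (posSemidef_smul_one_sub hA hr) hP
  rwa [sub_mul, smul_mul, Matrix.one_mul, trace_sub, trace_smul, smul_eq_mul, sub_nonneg] at this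

theorem trace_mul_mul_self_le {A P : Matrix ι ι ℝ} (hA : A.PosSemidef) (hP : P.PosSemidef)
    {r : ℝ} (hr : ‖A‖ ≤ r) : (A * P * A).trace ≤ r * (A * P).trace := by
  obtain ⟨C, rfl⟩ := exists_eq_conjTranspose_mul_self hA
  have hC : ‖C * Cᴴ‖ ≤ r := by
    rwa [l2_opNorm_conjTranspose_mul_self, ← l2_opNorm_conjTranspose,
      ← l2_opNorm_conjTranspose_mul_self, conjTranspose_conjTranspose] at hr
  calc (Cᴴ * C * P * (Cᴴ * C)).trace = (C * Cᴴ * (C * P * Cᴴ)).trace := by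
        rw [← Matrix.mul_assoc, trace_mul_comm]; simp only [Matrix.mul_assoc]
    _ ≤ r * (C * P * Cᴴ).trace := trace_mul_le_norm_mul_trace
        (isHermitian_mul_conjTranspose_self C) (hP.mul_mul_conjTranspose_same C) hC
    _ = r * (Cᴴ * C * P).trace := by rw [trace_mul_comm, Matrix.mul_assoc]

theorem norm_pow_le_trace_pow {X : Matrix ι ι ℝ} (hX : X.IsHermitian) {p : ℕ} (hp : p ≠ 0) :
    ‖X‖ ^ (2 * p) ≤ (X ^ (2 * p)).trace := by
  have norm_eq : ‖X‖ = ‖hX.eigenvalues‖ := by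
    conv_lhs => rw [hX.spectral_theorem, Unitary.conjStarAlgAut_apply, ← Unitary.coe_star,
      CStarRing.norm_mul_coe_unitary, CStarRing.norm_coe_unitary_mul, l2_opNorm_diagonal]
    rfl
  have trace_eq : (X ^ (2 * p)).trace = ∑ i, hX.eigenvalues i ^ (2 * p) := by
    conv_lhs => rw [hX.spectral_theorem, ← map_pow, diagonal_pow, Unitary.conjStarAlgAut_apply,
      trace_mul_comm, ← Matrix.mul_assoc, Unitary.coe_star_mul_self, Matrix.one_mul, trace_diagonal]
    rfl
  have hnonneg (i : ι) : 0 ≤ hX.eigenvalues i ^ (2 * p) := (even_two_mul p).pow_nonneg _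
  rcases isEmpty_or_nonempty ι with _ | _
  · rw [Subsingleton.elim X 0, norm_zero, zero_pow (by positivity), zero_pow (by positivity),
      trace_zero]
  · obtain ⟨i, hi⟩ := Finite.exists_max fun i => ‖hX.eigenvalues i‖
    calc ‖X‖ ^ (2 * p) ≤ ‖hX.eigenvalues i‖ ^ (2 * p) := by
          rw [norm_eq]
          gcongr
          exact (pi_norm_le_iff_of_nonneg (norm_nonneg _)).2 hi
      _ = hX.eigenvalues i ^ (2 * p) := (even_two_mul p).pow_abs _
      _ ≤ (X ^ (2 * p)).trace := trace_eq ▸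
          Finset.single_le_sum (fun j _ => hnonneg j) (Finset.mem_univ i)

end MatrixTrace

section CenteredSum

/-- The law of a random sample of size `n` from `ν`. -/
abbrev sampleLaw {S : Type*} [MeasurableSpace S] (ν : Measure S) (n : ℕ) : Measure (Fin n → S) :=
  Measure.pi fun _ => ν

variable {S E : Type*} [MeasurableSpace S] [NormedAddCommGroup E]

theorem memLp_eval_sample {ν : Measure S} [IsProbabilityMeasure ν] {p : ℝ≥0∞} {f : S → E}
    (hf : MemLp f p ν) {n : ℕ} (i : Fin n) :
    MemLp (fun z : Fin n → S => f (z i)) p (sampleLaw ν n) :=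
  hf.comp_measurePreserving (measurePreserving_eval (fun _ => ν) i)

variable [NormedSpace ℝ E]

/-- The deviation `∑ i, (f (z i) - E[f])` of the sum of `f` over a sample `z` from the law `ν` from
its mean. -/
def centeredSum (ν : Measure S) (f : S → E) {n : ℕ} (z : Fin n → S) : E :=
  ∑ i, (f (z i) - ∫ s, f s ∂ν)

theorem centeredSum_eq (ν : Measure S) (f : S → E) {n : ℕ} (z : Fin n → S) :
    centeredSum ν f z = ∑ i, f (z i) - n • ∫ s, f s ∂ν := by
  rw [centeredSum, Finset.sum_sub_distrib, Finset.sum_const, Finset.card_univ, Fintype.card_fin]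

theorem integral_comp_measurePreserving {α β : Type*} [MeasurableSpace α] [MeasurableSpace β]
    {μ : Measure α} {ν : Measure β} {f : α → β} (hf : MeasurePreserving f μ ν) {g : β → E}
    (hg : AEStronglyMeasurable g ν) : ∫ a, g (f a) ∂μ = ∫ b, g b ∂ν := by
  rw [← hf.map_eq, integral_map hf.aemeasurable (hf.map_eq ▸ hg)]

theorem centeredSum_tail_sub_swap (ν : Measure S) (f : S → E) {n : ℕ} (z : Fin (n + 1) → S)
    (i : Fin n) :
    centeredSum ν f (Fin.tail z) - centeredSum ν f (Fin.tail (z ∘ Equiv.swap 0 i.succ)) =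
      f (z i.succ) - f (z 0) := by
  rw [centeredSum, centeredSum, ← Finset.sum_sub_distrib, Finset.sum_eq_single i]
  · simp [Fin.tail]
  · intro j _ hj
    simp [Fin.tail, Equiv.swap_apply_of_ne_of_ne (Fin.succ_ne_zero j)
      (Fin.succ_injective n |>.ne hj)]
  · simp

variable {ν : Measure S} [IsProbabilityMeasure ν] {p : ℝ≥0∞} {f : S → E}

theorem memLp_centeredSum (hf : MemLp f p ν) (n : ℕ) :
    MemLp (centeredSum ν f : (Fin n → S) → E) p (sampleLaw ν n) :=
  memLp_finsetSum _ fun i _ => (memLp_eval_sample hf i).sub (memLp_const _)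

end CenteredSum

section GhostSample

variable {S : Type*} [MeasurableSpace S] (ν : Measure S) [IsProbabilityMeasure ν] (n : ℕ)

theorem measurePreserving_eval_zero_tail :
    MeasurePreserving (fun z : Fin (n + 1) → S => (z 0, Fin.tail z))
      (sampleLaw ν (n + 1)) (ν.prod (sampleLaw ν n)) := by
  exact measurePreserving_piFinSuccAbove (fun _ => ν) 0

theorem measurePreserving_tail :
    MeasurePreserving (Fin.tail : (Fin (n + 1) → S) → Fin n → S)
      (sampleLaw ν (n + 1)) (sampleLaw ν n) :=
  measurePreserving_snd.comp (measurePreserving_eval_zero_tail ν n)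

theorem measurePreserving_comp_perm {n : ℕ} (e : Equiv.Perm (Fin n)) :
    MeasurePreserving (fun z : Fin n → S => z ∘ e) (sampleLaw ν n) (sampleLaw ν n) := by
  exact measurePreserving_arrowCongr' (fun _ : Fin n => ν) (fun _ => ν) e.symm
    (MeasurableEquiv.refl S) fun _ => .id ν

end GhostSample

section RandomMatrix

variable {S ι : Type*} [MeasurableSpace S] [Fintype ι] [DecidableEq ι] {ν : Measure S}

theorem memLp_top_mul {f g : S → Matrix ι ι ℝ} (hf : MemLp f ∞ ν) (hg : MemLp g ∞ ν) :
    MemLp (fun s => f s * g s) ∞ ν :=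
  hg.mul' hf

theorem memLp_top_pow [IsFiniteMeasure ν] {f : S → Matrix ι ι ℝ} (hf : MemLp f ∞ ν) (k : ℕ) :
    MemLp (fun s => f s ^ k) ∞ ν := by
  induction k with
  | zero => simpa only [pow_zero] using memLp_const (1 : Matrix ι ι ℝ)
  | succ k ih => simpa only [pow_succ] using memLp_top_mul ih hf

theorem integrable_trace [IsFiniteMeasure ν] {f : S → Matrix ι ι ℝ} (hf : MemLp f ∞ ν) :
    Integrable (fun s => (f s).trace) ν :=
  (LinearMap.toContinuousLinearMap (traceLinearMap ι ℝ ℝ)).integrable_comp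
    (hf.integrable le_top)

theorem integral_trace_mul {f : S → Matrix ι ι ℝ} (hf : Integrable f ν) (C : Matrix ι ι ℝ) :
    ∫ s, (f s * C).trace ∂ν = ((∫ s, f s ∂ν) * C).trace :=
  (LinearMap.toContinuousLinearMap
    (traceLinearMap ι ℝ ℝ ∘ₗ LinearMap.mulRight ℝ C)).integral_comp_comm hf

theorem integral_isHermitian {f : S → Matrix ι ι ℝ} (hf : Integrable f ν)
    (hsymm : ∀ s, (f s).IsHermitian) : (∫ s, f s ∂ν).IsHermitian := by
  have := (LinearMap.toContinuousLinearMap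
    (transposeLinearEquiv ι ι ℝ ℝ).toLinearMap).integral_comp_comm hf
  rw [IsHermitian, conjTranspose_eq_transpose_of_trivial]
  refine Eq.trans this.symm (integral_congr_ae (.of_forall fun s => ?_))
  exact (conjTranspose_eq_transpose_of_trivial (f s)).symm.trans (hsymm s).eq

-- Symmetrize over `σ`: the factor `Y ^ (2 * m + 1)` may be replaced by half its increment.
theorem integral_trace_exchange_le [IsFiniteMeasure ν] {Y : S → Matrix ι ι ℝ} (hY : MemLp Y ∞ ν)
    (hsymm : ∀ s, (Y s).IsHermitian) {σ : S → S} (hσ : MeasurePreserving σ ν ν)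
    (hinv : Function.Involutive σ) (m : ℕ) :
    2 * ∫ s, ((Y s - Y (σ s)) * Y s ^ (2 * m + 1)).trace ∂ν ≤
      (2 * m + 1) * ∫ s, ((Y s - Y (σ s)) * Y s ^ (2 * m) * (Y s - Y (σ s))).trace ∂ν := by
  have hYσ : MemLp (fun s => Y (σ s)) ∞ ν := hY.comp_measurePreserving hσ
  have hD := hY.sub hYσ
  have hDσ : MemLp (fun s => Y (σ s) - Y s) ∞ ν := hYσ.sub hY
  have integrable_odd := integrable_trace (memLp_top_mul hD (memLp_top_pow hY (2 * m + 1)))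
  have integrable_oddσ := integrable_trace (memLp_top_mul hDσ (memLp_top_pow hYσ (2 * m + 1)))
  have integrable_even :=
    integrable_trace (memLp_top_mul (memLp_top_mul hD (memLp_top_pow hY (2 * m))) hD)
  have integrable_evenσ :=
    integrable_trace (memLp_top_mul (memLp_top_mul hDσ (memLp_top_pow hYσ (2 * m))) hDσ)
  have odd_exchange := integral_comp_measurePreserving hσ integrable_odd.aestronglyMeasurable
  have even_exchange := integral_comp_measurePreserving hσ integrable_even.aestronglyMeasurable
  simp only [Pi.sub_apply, hinv _] at *
  calc 2 * ∫ s, ((Y s - Y (σ s)) * Y s ^ (2 * m + 1)).trace ∂ν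
      = ∫ s, (((Y s - Y (σ s)) * Y s ^ (2 * m + 1)).trace +
          ((Y (σ s) - Y s) * Y (σ s) ^ (2 * m + 1)).trace) ∂ν := by
        rw [integral_add integrable_odd integrable_oddσ, odd_exchange, two_mul]
    _ ≤ ∫ s, (2 * m + 1) / 2 * (((Y s - Y (σ s)) * Y s ^ (2 * m) * (Y s - Y (σ s))).trace +
          ((Y (σ s) - Y s) * Y (σ s) ^ (2 * m) * (Y (σ s) - Y s)).trace) ∂ν := by
        refine integral_mono (integrable_odd.add integrable_oddσ)
          ((integrable_even.add integrable_evenσ).const_mul _) fun s => ?_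
        have := trace_sub_mul_odd_pow_sub_le (hsymm s) (hsymm (σ s)) m
        simp only [mul_sub, sub_mul, trace_sub] at this ⊢
        linarith
    _ = _ := by
        rw [integral_const_mul, integral_add integrable_even integrable_evenσ, even_exchange]
        ring

end RandomMatrix

section MatrixDeviation

variable {S ι : Type*} [MeasurableSpace S] [Fintype ι] [DecidableEq ι] {ν : Measure S}
  {A : S → Matrix ι ι ℝ} {n : ℕ} {r : ℝ}

theorem isHermitian_centeredSum (hA : Integrable A ν) (hpsd : ∀ s, (A s).PosSemidef)
    (z : Fin n → S) : (centeredSum ν A z).IsHermitian :=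
  isSelfAdjoint_sum _ fun i _ =>
    (hpsd (z i)).isHermitian.sub (integral_isHermitian hA fun s => (hpsd s).isHermitian)

variable [IsProbabilityMeasure ν]

theorem integral_trace_eval_zero_mul_tail {h : (Fin n → S) → Matrix ι ι ℝ} (hA : MemLp A ∞ ν)
    (hh : MemLp h ∞ (sampleLaw ν n)) :
    ∫ z, (A (z 0) * h (Fin.tail z)).trace ∂sampleLaw ν (n + 1) =
      ∫ z, ((∫ s, A s ∂ν) * h z).trace ∂sampleLaw ν n := by
  have hprod : Integrable (fun p : S × (Fin n → S) => (A p.1 * h p.2).trace)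
      (ν.prod (sampleLaw ν n)) :=
    integrable_trace (memLp_top_mul (hA.comp_measurePreserving measurePreserving_fst)
      (hh.comp_measurePreserving measurePreserving_snd))
  rw [integral_comp_measurePreserving (measurePreserving_eval_zero_tail ν n)
    hprod.aestronglyMeasurable, integral_prod_symm _ hprod]
  simp only [integral_trace_mul (hA.integrable le_top)]

-- Swapping the `i`-th observation with the ghost observation `z 0` changes the centered sum by
-- exactly `A (z i.succ) - A (z 0)`.
theorem integral_trace_sub_ghost_le (hA : MemLp A ∞ ν) (hpsd : ∀ s, (A s).PosSemidef)
    (hr : ∀ᵐ s ∂ν, ‖A s‖ ≤ r) (m : ℕ) (i : Fin n) :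
    ∫ z, ((A (z i.succ) - A (z 0)) *
        centeredSum ν A (Fin.tail z) ^ (2 * m + 1)).trace ∂sampleLaw ν (n + 1) ≤
      (2 * m + 1) * r * ∫ z, ((A (z i.succ) + A (z 0)) *
        centeredSum ν A (Fin.tail z) ^ (2 * m)).trace ∂sampleLaw ν (n + 1) := by
  have hX : MemLp (fun z => centeredSum ν A (Fin.tail z)) ∞ (sampleLaw ν (n + 1)) :=
    (memLp_centeredSum hA n).comp_measurePreserving (measurePreserving_tail ν n)
  have hAeval (j : Fin (n + 1)) := memLp_eval_sample hA j
  have hrz (j : Fin (n + 1)) : ∀ᵐ z ∂sampleLaw ν (n + 1), ‖A (z j)‖ ≤ r :=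
    (measurePreserving_eval (fun _ => ν) j).quasiMeasurePreserving.ae hr
  have hsymm (z : Fin (n + 1) → S) :=
    isHermitian_centeredSum (hA.integrable le_top) hpsd (Fin.tail z)
  have exchange := integral_trace_exchange_le hX hsymm
    (measurePreserving_comp_perm ν (Equiv.swap 0 i.succ)) (fun z => by ext j; simp) m
  simp only [centeredSum_tail_sub_swap] at exchange
  have quadratic_le : ∫ z, ((A (z i.succ) - A (z 0)) *
      centeredSum ν A (Fin.tail z) ^ (2 * m) * (A (z i.succ) - A (z 0))).trace
        ∂sampleLaw ν (n + 1) ≤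
      ∫ z, 2 * r * ((A (z i.succ) + A (z 0)) *
        centeredSum ν A (Fin.tail z) ^ (2 * m)).trace ∂sampleLaw ν (n + 1) := by
    refine integral_mono_ae
      (integrable_trace (memLp_top_mul (memLp_top_mul ((hAeval i.succ).sub (hAeval 0))
        (memLp_top_pow hX (2 * m))) ((hAeval i.succ).sub (hAeval 0))))
      ((integrable_trace (memLp_top_mul ((hAeval i.succ).add (hAeval 0))
        (memLp_top_pow hX (2 * m)))).const_mul _) ?_
    filter_upwards [hrz i.succ, hrz 0] with z hi h0
    have hP := posSemidef_even_pow (hsymm z) m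
    have split := trace_sub_mul_mul_sub_le (hpsd (z i.succ)).isHermitian (hpsd (z 0)).isHermitian hP
    have bound_i := trace_mul_mul_self_le (hpsd (z i.succ)) hP hi
    have bound_0 := trace_mul_mul_self_le (hpsd (z 0)) hP h0
    rw [add_mul, trace_add]
    linarith
  rw [integral_const_mul] at quadratic_le
  have := mul_le_mul_of_nonneg_left quadratic_le (by positivity : (0 : ℝ) ≤ 2 * m + 1)
  linarith

theorem sum_integral_trace_mul_centeredSum_pow (hA : MemLp A ∞ ν) (k : ℕ) :
    ∑ i : Fin n, ∫ z,
        (A (z i.succ) * centeredSum ν A (Fin.tail z) ^ k).trace ∂sampleLaw ν (n + 1) =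
      ∫ z, (centeredSum ν A z ^ (k + 1)).trace ∂sampleLaw ν n +
        n * ∫ z, ((∫ s, A s ∂ν) * centeredSum ν A z ^ k).trace
          ∂sampleLaw ν n := by
  have hX := memLp_centeredSum hA n
  have integrable_i (i : Fin n) := integrable_trace (memLp_top_mul
    (memLp_eval_sample hA i) (memLp_top_pow hX k))
  have drop_ghost (i : Fin n) := integral_comp_measurePreserving (measurePreserving_tail ν n)
    (integrable_i i).aestronglyMeasurable
  calc _ = ∑ i : Fin n, ∫ z, (A (z i) * centeredSum ν A z ^ k).trace
          ∂sampleLaw ν n := Finset.sum_congr rfl fun i _ => drop_ghost i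
    _ = ∫ z, ((centeredSum ν A z ^ (k + 1)).trace +
          n * ((∫ s, A s ∂ν) * centeredSum ν A z ^ k).trace) ∂sampleLaw ν n := by
        rw [← integral_finsetSum _ fun i _ => integrable_i i]
        refine integral_congr_ae (.of_forall fun z => ?_)
        have sum_eq : ∑ i, A (z i) = centeredSum ν A z + n • ∫ s, A s ∂ν := by
          rw [centeredSum_eq, sub_add_cancel]
        beta_reduce
        rw [← trace_sum, ← Finset.sum_mul, sum_eq, add_mul, ← pow_succ', trace_add, smul_mul,
          trace_smul, nsmul_eq_mul]
    _ = _ := by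
        rw [integral_add (integrable_trace (memLp_top_pow hX _)) ((integrable_trace
          (memLp_top_mul (memLp_const _) (memLp_top_pow hX k))).const_mul _), integral_const_mul]

theorem integral_trace_centeredSum_pow_succ_le (hA : MemLp A ∞ ν) (hpsd : ∀ s, (A s).PosSemidef)
    (hr : ∀ᵐ s ∂ν, ‖A s‖ ≤ r) (m : ℕ) :
    ∫ z, (centeredSum ν A z ^ (2 * m + 2)).trace ∂sampleLaw ν n ≤
      (2 * m + 1) * r *
        (∫ z, (centeredSum ν A z ^ (2 * m + 1)).trace ∂sampleLaw ν n +
          2 * n * ∫ z, ((∫ s, A s ∂ν) * centeredSum ν A z ^ (2 * m)).trace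
            ∂sampleLaw ν n) := by
  have hX : MemLp (fun z => centeredSum ν A (Fin.tail z)) ∞ (sampleLaw ν (n + 1)) :=
    (memLp_centeredSum hA n).comp_measurePreserving (measurePreserving_tail ν n)
  have integrable_eval (j : Fin (n + 1)) (k : ℕ) :=
    integrable_trace (memLp_top_mul (memLp_eval_sample hA j) (memLp_top_pow hX k))
  have ghost (k : ℕ) := integral_trace_eval_zero_mul_tail hA
    (memLp_top_pow (memLp_centeredSum hA n) k)
  have exchange := Finset.sum_le_sum fun i (_ : i ∈ Finset.univ) =>
    integral_trace_sub_ghost_le (n := n) hA hpsd hr m i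
  rw [← Finset.mul_sum] at exchange
  simp only [sub_mul _ _ (centeredSum ν A _ ^ _), add_mul _ _ (centeredSum ν A _ ^ _), trace_sub,
    trace_add] at exchange
  simp only [fun (i : Fin n) k => integral_sub (integrable_eval i.succ k) (integrable_eval 0 k),
    fun (i : Fin n) k => integral_add (integrable_eval i.succ k) (integrable_eval 0 k),
    Finset.sum_sub_distrib, Finset.sum_add_distrib, sum_integral_trace_mul_centeredSum_pow hA,
    ghost, Finset.sum_const, Finset.card_univ, Fintype.card_fin, nsmul_eq_mul] at exchange
  linarith

theorem integral_trace_centeredSum_even_pow_succ_le (hA : MemLp A ∞ ν)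
    (hpsd : ∀ s, (A s).PosSemidef) (hr0 : 0 ≤ r) (hr : ∀ᵐ s ∂ν, ‖A s‖ ≤ r) {g : ℝ}
    (hg : ‖∫ s, A s ∂ν‖ ≤ g) (m : ℕ) :
    ∫ z, (centeredSum ν A z ^ (2 * (m + 1))).trace ∂sampleLaw ν n ≤
      (((2 * m + 1) * r) ^ 2 + 4 * n * g * ((2 * m + 1) * r)) *
        ∫ z, (centeredSum ν A z ^ (2 * m)).trace ∂sampleLaw ν n := by
  set t := (2 * m + 1) * r with ht
  have : 0 ≤ t := by positivity
  have hX := memLp_centeredSum hA n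
  have integrable_pow (k : ℕ) := integrable_trace (memLp_top_pow hX k)
  have hsymm (z : Fin n → S) := isHermitian_centeredSum (hA.integrable le_top) hpsd z
  have step := integral_trace_centeredSum_pow_succ_le (n := n) hA hpsd hr m
  have young : 2 * t * ∫ z, (centeredSum ν A z ^ (2 * m + 1)).trace
      ∂sampleLaw ν n ≤
      ∫ z, (centeredSum ν A z ^ (2 * m + 2)).trace ∂sampleLaw ν n +
        t ^ 2 * ∫ z, (centeredSum ν A z ^ (2 * m)).trace ∂sampleLaw ν n := by
    rw [← integral_const_mul, ← integral_const_mul, ← integral_add (integrable_pow _)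
      ((integrable_pow _).const_mul _)]
    exact integral_mono ((integrable_pow _).const_mul _)
      ((integrable_pow _).add ((integrable_pow _).const_mul _))
      fun z => two_mul_mul_trace_odd_pow_le (hsymm z) t m
  have mean_le : ∫ z, ((∫ s, A s ∂ν) * centeredSum ν A z ^ (2 * m)).trace
      ∂sampleLaw ν n ≤
      g * ∫ z, (centeredSum ν A z ^ (2 * m)).trace ∂sampleLaw ν n := by
    rw [← integral_const_mul]
    exact integral_mono (integrable_trace (memLp_top_mul (memLp_const _) (memLp_top_pow hX _)))
      ((integrable_pow _).const_mul _) fun z => trace_mul_le_norm_mul_trace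
        (integral_isHermitian (hA.integrable le_top) fun s => (hpsd s).isHermitian)
        (posSemidef_even_pow (hsymm z) m) hg
  have := mul_le_mul_of_nonneg_left mean_le (by positivity : (0 : ℝ) ≤ 2 * t * (2 * n))
  rw [← ht] at step
  rw [mul_add_one]
  linarith

theorem integral_trace_centeredSum_even_pow_le (hA : MemLp A ∞ ν)
    (hpsd : ∀ s, (A s).PosSemidef) (hr0 : 0 ≤ r) (hr : ∀ᵐ s ∂ν, ‖A s‖ ≤ r) {g : ℝ}
    (hg : ‖∫ s, A s ∂ν‖ ≤ g) {m p : ℕ} (hmp : m ≤ p) :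
    ∫ z, (centeredSum ν A z ^ (2 * m)).trace ∂sampleLaw ν n ≤
      Fintype.card ι * ((2 * p * r) ^ 2 + 4 * n * g * (2 * p * r)) ^ m := by
  have hg0 : 0 ≤ g := (norm_nonneg _).trans hg
  induction m with
  | zero => simp
  | succ m ih =>
    have ht : (2 * m + 1) * r ≤ 2 * p * r := by
      have : (m : ℝ) + 1 ≤ p := by exact_mod_cast hmp
      gcongr
      linarith
    have hnonneg : 0 ≤ ∫ z, (centeredSum ν A z ^ (2 * m)).trace
        ∂sampleLaw ν n :=
      integral_nonneg fun z => (posSemidef_even_pow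
        (isHermitian_centeredSum (hA.integrable le_top) hpsd z) m).trace_nonneg
    calc _ ≤ (((2 * m + 1) * r) ^ 2 + 4 * n * g * ((2 * m + 1) * r)) *
          ∫ z, (centeredSum ν A z ^ (2 * m)).trace ∂sampleLaw ν n :=
        integral_trace_centeredSum_even_pow_succ_le hA hpsd hr0 hr hg m
      _ ≤ ((2 * p * r) ^ 2 + 4 * n * g * (2 * p * r)) *
          (Fintype.card ι * ((2 * p * r) ^ 2 + 4 * n * g * (2 * p * r)) ^ m) := by
        gcongr
        exact ih (Nat.le_of_succ_le hmp)
      _ = _ := by ring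

theorem measure_norm_centeredSum_gt_le_pow (hA : MemLp A ∞ ν)
    (hpsd : ∀ s, (A s).PosSemidef) (hr0 : 0 ≤ r) (hr : ∀ᵐ s ∂ν, ‖A s‖ ≤ r) {g : ℝ}
    (hg : ‖∫ s, A s ∂ν‖ ≤ g) {p : ℕ} (hp : p ≠ 0) {t : ℝ} (ht : 0 < t) :
    (sampleLaw ν n).real {z : Fin n → S | t < ‖centeredSum ν A z‖} ≤
      Fintype.card ι * (((2 * p * r) ^ 2 + 4 * n * g * (2 * p * r)) / t ^ 2) ^ p := by
  have hsymm (z : Fin n → S) := isHermitian_centeredSum (hA.integrable le_top) hpsd z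
  have subset : {z : Fin n → S | t < ‖centeredSum ν A z‖} ⊆
      {z | t ^ (2 * p) ≤ (centeredSum ν A z ^ (2 * p)).trace} := fun z hz =>
    (pow_le_pow_left₀ ht.le (le_of_lt hz) _).trans (norm_pow_le_trace_pow (hsymm z) hp)
  have markov := mul_meas_ge_le_integral_of_nonneg
    (.of_forall fun z : Fin n → S => (posSemidef_even_pow (hsymm z) p).trace_nonneg)
    (integrable_trace (memLp_top_pow (memLp_centeredSum hA n) (2 * p))) (t ^ (2 * p))
  rw [div_pow, ← pow_mul, ← mul_div_assoc, le_div_iff₀ (by positivity), mul_comm]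
  exact (mul_le_mul_of_nonneg_left (measureReal_mono subset) (by positivity)).trans
    (markov.trans (integral_trace_centeredSum_even_pow_le hA hpsd hr0 hr hg le_rfl))

end MatrixDeviation

section MatrixTail

variable {S : Type*} [MeasurableSpace S] {ν : Measure S} [IsProbabilityMeasure ν]
  {ι : Type*} [Fintype ι] [DecidableEq ι] {A : S → Matrix ι ι ℝ} {n : ℕ} {r : ℝ}

theorem measure_norm_centeredSum_gt_le (hA : MemLp A ∞ ν) (hpsd : ∀ s, (A s).PosSemidef)
    (hr0 : 0 ≤ r) (hr : ∀ᵐ s ∂ν, ‖A s‖ ≤ r) {g : ℝ} (hg : ‖∫ s, A s ∂ν‖ ≤ g) {p : ℕ}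
    (hp : p ≠ 0) (hlog : Real.log (Fintype.card ι) ≤ p) {t : ℝ} (ht : 0 < t) :
    (sampleLaw ν n).real {z : Fin n → S | t < ‖centeredSum ν A z‖} ≤
      Real.exp 1 * (((2 * p * r) ^ 2 + 4 * n * g * (2 * p * r)) / t ^ 2) := by
  have hg0 : 0 ≤ g := (norm_nonneg _).trans hg
  set x := ((2 * p * r) ^ 2 + 4 * n * g * (2 * p * r)) / t ^ 2
  have : 0 ≤ x := by positivity
  obtain large | small := le_total 1 (Real.exp 1 * x)
  · exact measureReal_le_one.trans large
  calc (sampleLaw ν n).real {z : Fin n → S | t < ‖centeredSum ν A z‖}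
    _ ≤ Fintype.card ι * x ^ p := measure_norm_centeredSum_gt_le_pow hA hpsd hr0 hr hg hp ht
    _ ≤ Real.exp p * x ^ p := by
      gcongr
      exact (Real.le_exp_log _).trans (Real.exp_le_exp.2 hlog)
    _ = (Real.exp 1 * x) ^ p := by rw [mul_pow, ← Real.exp_nat_mul, mul_one]
    _ ≤ Real.exp 1 * x := pow_le_of_le_one (by positivity) small hp

end MatrixTail

section TwoStageLeastSquares

section Projection

variable {m n : Type*} [Fintype m] [Fintype n]

/-- The fitted-value matrix of least squares on the columns of `B`, where `N` stands for a
generalized inverse of `Bᵀ * B`. -/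
def hatMatrix (B : Matrix n m ℝ) (N : Matrix m m ℝ) : Matrix n n ℝ := B * N * Bᵀ

variable {B : Matrix n m ℝ} {N : Matrix m m ℝ}

theorem hatMatrix_mul_self (hN : Bᵀ * B * N * (Bᵀ * B) = Bᵀ * B) : hatMatrix B N * B = B := by
  classical
  have h : Bᴴ * B * (N * (Bᵀ * B) - 1) = 0 := by
    rw [conjTranspose_eq_transpose_of_trivial, Matrix.mul_sub, ← Matrix.mul_assoc, hN,
      Matrix.mul_one, sub_self]
  rw [Matrix.conjTranspose_mul_self_mul_eq_zero, Matrix.mul_sub, Matrix.mul_one, sub_eq_zero] at h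
  simpa only [hatMatrix, Matrix.mul_assoc] using h

theorem transpose_hatMatrix_mul_hatMatrix (hN : Bᵀ * B * N * (Bᵀ * B) = Bᵀ * B) :
    (hatMatrix B N)ᵀ * hatMatrix B N = hatMatrix B N := by
  have hNt : Bᵀ * B * Nᵀ * (Bᵀ * B) = Bᵀ * B := by
    simpa only [Matrix.transpose_mul, Matrix.transpose_transpose, Matrix.mul_assoc]
      using congrArg Matrix.transpose hN
  have transpose : (hatMatrix B N)ᵀ = hatMatrix B Nᵀ := by
    simp only [hatMatrix, Matrix.transpose_mul, Matrix.transpose_transpose, Matrix.mul_assoc]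
  calc (hatMatrix B N)ᵀ * hatMatrix B N = hatMatrix B Nᵀ * B * (N * Bᵀ) := by
        rw [transpose, hatMatrix, hatMatrix]
        simp only [Matrix.mul_assoc]
    _ = hatMatrix B N := by rw [hatMatrix_mul_self hNt, hatMatrix, Matrix.mul_assoc]

theorem transpose_hatMatrix (hN : Bᵀ * B * N * (Bᵀ * B) = Bᵀ * B) :
    (hatMatrix B N)ᵀ = hatMatrix B N := by
  conv_lhs => rw [← transpose_hatMatrix_mul_hatMatrix hN]
  rw [Matrix.transpose_mul, Matrix.transpose_transpose, transpose_hatMatrix_mul_hatMatrix hN]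

theorem isStarProjection_hatMatrix (hN : Bᵀ * B * N * (Bᵀ * B) = Bᵀ * B) :
    IsStarProjection (hatMatrix B N) where
  isIdempotentElem := by
    have h := transpose_hatMatrix_mul_hatMatrix hN
    rwa [transpose_hatMatrix hN] at h
  isSelfAdjoint := (conjTranspose_eq_transpose_of_trivial _).trans (transpose_hatMatrix hN)

theorem norm_hatMatrix_mulVec_le (hN : Bᵀ * B * N * (Bᵀ * B) = Bᵀ * B) (y : n → ℝ) :
    ‖toLp 2 (hatMatrix B N *ᵥ y)‖ ≤ ‖toLp 2 y‖ := by
  classical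
  exact (Matrix.l2_opNorm_mulVec _ (toLp 2 y)).trans
    (mul_le_of_le_one_left (norm_nonneg _) (isStarProjection_hatMatrix hN).norm_le)

end Projection

section Estimator

variable {ginv : (k : ℕ) → Matrix (Fin k) (Fin k) ℝ → Matrix (Fin k) (Fin k) ℝ} {n J K : ℕ}

/-- With `A` the projection of the regressors on the instruments, 2SLS is least squares on `A`. -/
theorem norm_hatMatrix_mulVec_tslsCoef_sub_le (hginv : IsGeneralizedInverse ginv)
    (Ψ : Matrix (Fin n) (Fin J) ℝ) (B : Matrix (Fin n) (Fin K) ℝ) (y : Fin n → ℝ)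
    (c : Fin J → ℝ) :
    ‖toLp 2 (hatMatrix B (ginv K (Bᵀ * B)) *ᵥ Ψ *ᵥ (tslsCoef ginv Ψ B y - c))‖ ≤
      ‖toLp 2 (hatMatrix B (ginv K (Bᵀ * B)) *ᵥ (y - Ψ *ᵥ c))‖ := by
  have hB := hginv K (Bᵀ * B)
  set Q := hatMatrix B (ginv K (Bᵀ * B)) with hQ
  have idem : Q * Q = Q := (isStarProjection_hatMatrix hB).isIdempotentElem
  set A := Q * Ψ
  have transpose_A : Aᵀ = Ψᵀ * Q := by rw [Matrix.transpose_mul, transpose_hatMatrix hB]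
  have transpose_A_mul : Aᵀ * Q = Aᵀ := by rw [transpose_A, Matrix.mul_assoc, idem]
  have normal_matrix : Aᵀ * Ψ = Aᵀ * A := by
    conv_lhs => rw [← transpose_A_mul, Matrix.mul_assoc]
  have hN := hginv J (Aᵀ * A)
  set H := hatMatrix A (ginv J (Aᵀ * A)) with hH
  have coef : A *ᵥ tslsCoef ginv Ψ B y = H *ᵥ y := by
    have instrumented : Ψᵀ * B * ginv K (Bᵀ * B) * Bᵀ = Aᵀ := by
      rw [transpose_A, hQ, hatMatrix]
      simp only [Matrix.mul_assoc]
    rw [tslsCoef, instrumented, normal_matrix, Matrix.mulVec_mulVec, hH, hatMatrix,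
      Matrix.mul_assoc A]
  have absorb : H * Q = H := by
    rw [hH, hatMatrix, Matrix.mul_assoc, transpose_A_mul]
  have residual : Q *ᵥ Ψ *ᵥ (tslsCoef ginv Ψ B y - c) = H *ᵥ Q *ᵥ (y - Ψ *ᵥ c) := by
    rw [Matrix.mulVec_mulVec, Matrix.mulVec_mulVec, absorb, Matrix.mulVec_sub, Matrix.mulVec_sub,
      coef, Matrix.mulVec_mulVec, ← absorb, Matrix.mul_assoc H, hatMatrix_mul_self hN]
  rw [residual]
  exact norm_hatMatrix_mulVec_le hN _

end Estimator

end TwoStageLeastSquares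

section Stability

theorem dotProduct_self_eq_norm_sq {n : Type*} [Fintype n] (v : n → ℝ) :
    v ⬝ᵥ v = ‖toLp 2 v‖ ^ 2 := by
  rw [← real_inner_self_eq_norm_sq, EuclideanSpace.inner_toLp_toLp, star_trivial]

theorem abs_dotProduct_le_norm_mul_norm {n : Type*} [Fintype n] (v w : n → ℝ) :
    |v ⬝ᵥ w| ≤ ‖toLp 2 v‖ * ‖toLp 2 w‖ := by
  have h := abs_real_inner_le_norm (toLp 2 v) (toLp 2 w)
  rwa [EuclideanSpace.inner_toLp_toLp, star_trivial, dotProduct_comm] at h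

theorem norm_mulVec_le {m n : Type*} [Fintype m] [Fintype n] [DecidableEq n] (A : Matrix m n ℝ)
    (v : n → ℝ) : ‖toLp 2 (A *ᵥ v)‖ ≤ ‖A‖ * ‖toLp 2 v‖ :=
  Matrix.l2_opNorm_mulVec A (toLp 2 v)

section NearIsometry

variable {m n : Type*} [Fintype m] [DecidableEq m] [Fintype n] {F : Matrix n m ℝ} {r δ : ℝ}

theorem le_norm_mulVec_sq (hF : ‖Fᵀ * F - r • 1‖ ≤ δ) (p : m → ℝ) :
    (r - δ) * ‖toLp 2 p‖ ^ 2 ≤ ‖toLp 2 (F *ᵥ p)‖ ^ 2 := by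
  have expand : ‖toLp 2 (F *ᵥ p)‖ ^ 2 =
      r * ‖toLp 2 p‖ ^ 2 + p ⬝ᵥ (Fᵀ * F - r • 1) *ᵥ p := by
    rw [Matrix.sub_mulVec, Matrix.smul_mulVec, Matrix.one_mulVec, dotProduct_sub, dotProduct_smul,
      ← dotProduct_self_eq_norm_sq, ← dotProduct_self_eq_norm_sq, ← Matrix.mulVec_mulVec,
      Matrix.dotProduct_mulVec p, Matrix.vecMul_transpose, smul_eq_mul, add_sub_cancel]
  have error : |p ⬝ᵥ (Fᵀ * F - r • 1) *ᵥ p| ≤ δ * ‖toLp 2 p‖ ^ 2 :=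
    calc |p ⬝ᵥ (Fᵀ * F - r • 1) *ᵥ p|
      _ ≤ ‖toLp 2 p‖ * ‖toLp 2 ((Fᵀ * F - r • 1) *ᵥ p)‖ := abs_dotProduct_le_norm_mul_norm _ _
      _ ≤ ‖toLp 2 p‖ * (δ * ‖toLp 2 p‖) := by
        gcongr
        exact (norm_mulVec_le _ p).trans (by gcongr)
      _ = δ * ‖toLp 2 p‖ ^ 2 := by ring
  rw [expand]
  linarith [neg_le_of_abs_le error]

theorem norm_sq_le_of_norm_transpose_mul_self_sub_le (hr : 0 ≤ r)
    (hF : ‖Fᵀ * F - r • 1‖ ≤ δ) : ‖F‖ ^ 2 ≤ r + δ :=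
  calc ‖F‖ ^ 2 = ‖r • (1 : Matrix m m ℝ) + (Fᵀ * F - r • 1)‖ := by
        rw [add_sub_cancel, ← conjTranspose_eq_transpose_of_trivial,
          Matrix.l2_opNorm_conjTranspose_mul_self, sq]
    _ ≤ r * 1 + δ := by
        refine (norm_add_le _ _).trans (add_le_add ?_ hF)
        rw [norm_smul, Real.norm_of_nonneg hr]
        gcongr
        exact (IsStarProjection.one _).norm_le
    _ = r + δ := by rw [mul_one]

variable {B : Matrix n m ℝ} {N Q R : Matrix m m ℝ}

theorem norm_transpose_mulVec_le (hN : Bᵀ * B * N * (Bᵀ * B) = Bᵀ * B)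
    (hF : F = B * Q) (y : n → ℝ) : ‖toLp 2 (Fᵀ *ᵥ y)‖ ≤ ‖F‖ * ‖toLp 2 (hatMatrix B N *ᵥ y)‖ := by
  have fix : Fᵀ * hatMatrix B N = Fᵀ := by
    rw [← transpose_hatMatrix hN, ← Matrix.transpose_mul, hF, ← Matrix.mul_assoc,
      hatMatrix_mul_self hN]
  classical
  calc ‖toLp 2 (Fᵀ *ᵥ y)‖ = ‖toLp 2 (Fᵀ *ᵥ hatMatrix B N *ᵥ y)‖ := by
        rw [Matrix.mulVec_mulVec, fix]
    _ ≤ ‖F‖ * ‖toLp 2 (hatMatrix B N *ᵥ y)‖ := by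
        rw [← Matrix.l2_opNorm_conjTranspose F, conjTranspose_eq_transpose_of_trivial]
        exact norm_mulVec_le _ _

theorem mul_norm_hatMatrix_mulVec_sq_le (hN : Bᵀ * B * N * (Bᵀ * B) = Bᵀ * B) (hB : B = F * R)
    (hF : ‖Fᵀ * F - r • 1‖ ≤ δ) (hδ : δ ≤ r) (y : n → ℝ) :
    (r - δ) * ‖toLp 2 (hatMatrix B N *ᵥ y)‖ ^ 2 ≤ ‖toLp 2 (Fᵀ *ᵥ y)‖ ^ 2 := by
  set p := R *ᵥ N *ᵥ Bᵀ *ᵥ y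
  have fitted : hatMatrix B N *ᵥ y = F *ᵥ p := by
    simp only [p, hatMatrix, hB, Matrix.mulVec_mulVec, Matrix.mul_assoc]
  have lower := le_norm_mulVec_sq hF p
  rw [← fitted] at lower
  have norm_sq : ‖toLp 2 (hatMatrix B N *ᵥ y)‖ ^ 2 ≤ ‖toLp 2 (Fᵀ *ᵥ y)‖ * ‖toLp 2 p‖ :=
    calc ‖toLp 2 (hatMatrix B N *ᵥ y)‖ ^ 2 = y ⬝ᵥ hatMatrix B N *ᵥ y := by
          rw [← dotProduct_self_eq_norm_sq, Matrix.dotProduct_mulVec, Matrix.vecMul_mulVec,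
            transpose_hatMatrix_mul_hatMatrix hN, ← Matrix.dotProduct_mulVec]
      _ = Fᵀ *ᵥ y ⬝ᵥ p := by rw [fitted, Matrix.dotProduct_mulVec, ← Matrix.mulVec_transpose]
      _ ≤ _ := (le_abs_self _).trans (abs_dotProduct_le_norm_mul_norm _ _)
  set x := ‖toLp 2 (hatMatrix B N *ᵥ y)‖
  obtain hx | hx : x = 0 ∨ 0 < x := (norm_nonneg _).eq_or_lt'
  · rw [hx, zero_pow two_ne_zero, mul_zero]
    positivity
  refine le_of_mul_le_mul_right ?_ (pow_pos hx 2)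
  calc (r - δ) * x ^ 2 * x ^ 2 = (r - δ) * (x ^ 2) ^ 2 := by ring
    _ ≤ (r - δ) * (‖toLp 2 (Fᵀ *ᵥ y)‖ * ‖toLp 2 p‖) ^ 2 := by
      have := sub_nonneg.2 hδ
      gcongr
    _ = ‖toLp 2 (Fᵀ *ᵥ y)‖ ^ 2 * ((r - δ) * ‖toLp 2 p‖ ^ 2) := by ring
    _ ≤ ‖toLp 2 (Fᵀ *ᵥ y)‖ ^ 2 * x ^ 2 := by gcongr

end NearIsometry

variable {ginv : (k : ℕ) → Matrix (Fin k) (Fin k) ℝ → Matrix (Fin k) (Fin k) ℝ} {n J K : ℕ}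
  {Ψ G : Matrix (Fin n) (Fin J) ℝ} {B F : Matrix (Fin n) (Fin K) ℝ}

theorem norm_transpose_mulVec_tslsCoef_sub_le (hginv : IsGeneralizedInverse ginv)
    {Q R : Matrix (Fin K) (Fin K) ℝ} (hF : F = B * Q) (hB : B = F * R)
    (hFF : ‖Fᵀ * F - (n : ℝ) • 1‖ ≤ n / 8) (y : Fin n → ℝ) (c : Fin J → ℝ) :
    ‖toLp 2 (Fᵀ *ᵥ Ψ *ᵥ (tslsCoef ginv Ψ B y - c))‖ ≤ 2 * ‖toLp 2 (Fᵀ *ᵥ (y - Ψ *ᵥ c))‖ := by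
  have hN := hginv K (Bᵀ * B)
  have upper := norm_transpose_mulVec_le hN hF (Ψ *ᵥ (tslsCoef ginv Ψ B y - c))
  have contraction := norm_hatMatrix_mulVec_tslsCoef_sub_le hginv Ψ B y c
  have lower := mul_norm_hatMatrix_mulVec_sq_le hN hB hFF (by linarith [n.cast_nonneg (α := ℝ)])
    (y - Ψ *ᵥ c)
  have norm_F := norm_sq_le_of_norm_transpose_mul_self_sub_le n.cast_nonneg hFF
  set a := ‖toLp 2 (hatMatrix B (ginv K (Bᵀ * B)) *ᵥ (y - Ψ *ᵥ c))‖
  refine abs_le_of_sq_le_sq' ?_ (by positivity) |>.2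
  calc _ ≤ (‖F‖ * a) ^ 2 := by
        gcongr
        exact upper.trans (by gcongr)
    _ = ‖F‖ ^ 2 * a ^ 2 := mul_pow _ _ _
    _ ≤ (n + n / 8) * a ^ 2 := by gcongr
    _ ≤ 4 * ((n - n / 8) * a ^ 2) := by nlinarith [mul_nonneg n.cast_nonneg (sq_nonneg a)]
    _ ≤ 4 * ‖toLp 2 (Fᵀ *ᵥ (y - Ψ *ᵥ c))‖ ^ 2 := by gcongr
    _ = _ := by ring

theorem norm_mulVec_tslsCoef_sub_le (hginv : IsGeneralizedInverse ginv)
    {Q R : Matrix (Fin K) (Fin K) ℝ} {L : Matrix (Fin J) (Fin J) ℝ} (hF : F = B * Q)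
    (hB : B = F * R) (hΨ : Ψ = G * L) {S : Matrix (Fin K) (Fin J) ℝ} {τ : ℝ} (hτ : 1 ≤ τ)
    (hS : ∀ q, 3 / 4 * ‖toLp 2 q‖ ≤ τ * ‖toLp 2 (S *ᵥ q)‖)
    (hFF : ‖Fᵀ * F - (n : ℝ) • 1‖ ≤ n / (8 * τ)) (hFG : ‖Fᵀ * G - (n : ℝ) • S‖ ≤ n / (8 * τ))
    (hn : 0 < n) (y : Fin n → ℝ) (c : Fin J → ℝ) :
    ‖toLp 2 (L *ᵥ (tslsCoef ginv Ψ B y - c))‖ ≤ 4 * τ / n * ‖toLp 2 (Fᵀ *ᵥ (y - Ψ *ᵥ c))‖ := by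
  set q := L *ᵥ (tslsCoef ginv Ψ B y - c)
  have projected : ‖toLp 2 (Fᵀ *ᵥ G *ᵥ q)‖ ≤ 2 * ‖toLp 2 (Fᵀ *ᵥ (y - Ψ *ᵥ c))‖ := by
    have h := norm_transpose_mulVec_tslsCoef_sub_le (Ψ := Ψ) hginv hF hB
      (hFF.trans (by gcongr; linarith)) y c
    rwa [hΨ, ← Matrix.mulVec_mulVec, ← hΨ] at h
  have first_stage : n * ‖toLp 2 (S *ᵥ q)‖ ≤
      ‖toLp 2 (Fᵀ *ᵥ G *ᵥ q)‖ + n / (8 * τ) * ‖toLp 2 q‖ :=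
    calc n * ‖toLp 2 (S *ᵥ q)‖ =
          ‖toLp 2 (Fᵀ *ᵥ G *ᵥ q) - toLp 2 ((Fᵀ * G - (n : ℝ) • S) *ᵥ q)‖ := by
          rw [← WithLp.toLp_sub, Matrix.sub_mulVec, ← Matrix.mulVec_mulVec q Fᵀ, sub_sub_cancel,
            Matrix.smul_mulVec, WithLp.toLp_smul, norm_smul, Real.norm_natCast]
      _ ≤ _ := (norm_sub_le _ _).trans (by gcongr; exact (norm_mulVec_le _ q).trans (by gcongr))
  have hn' : (0 : ℝ) < n := by exact_mod_cast hn
  have lower := hS q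
  have scaled : τ * (n * ‖toLp 2 (S *ᵥ q)‖) ≤
      τ * ‖toLp 2 (Fᵀ *ᵥ G *ᵥ q)‖ + n / 8 * ‖toLp 2 q‖ :=
    (mul_le_mul_of_nonneg_left first_stage (by positivity)).trans_eq (by field_simp)
  rw [div_mul_eq_mul_div, le_div_iff₀ hn']
  nlinarith [mul_le_mul_of_nonneg_left lower hn'.le, norm_nonneg (toLp 2 q),
    mul_le_mul_of_nonneg_left projected (zero_le_one.trans hτ),
    mul_nonneg hn'.le (norm_nonneg (toLp 2 q))]

end Stability

section InverseSquareRoot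

variable {J : ℕ} {G : Matrix (Fin J) (Fin J) ℝ}

theorem transpose_invSqrt (G : Matrix (Fin J) (Fin J) ℝ) : (invSqrt G)ᵀ = invSqrt G :=
  (conjTranspose_eq_transpose_of_trivial _).symm.trans (cfc_predicate _ G : IsSelfAdjoint _)

theorem invSqrt_mul_mul_invSqrt (hG : G.PosDef) : invSqrt G * G * invSqrt G = 1 := by
  have spectrum_pos : ∀ t ∈ spectrum ℝ G, 0 < t := by
    rw [hG.isHermitian.spectrum_real_eq_range_eigenvalues]
    rintro _ ⟨i, rfl⟩
    exact hG.eigenvalues_pos i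
  have hcont : ContinuousOn (fun t : ℝ => (√t)⁻¹) (spectrum ℝ G) :=
    Real.continuous_sqrt.continuousOn.inv₀ fun t ht => (Real.sqrt_pos.2 (spectrum_pos t ht)).ne'
  calc invSqrt G * G * invSqrt G = cfc (fun t : ℝ => (√t)⁻¹ * t * (√t)⁻¹) G := by
        rw [cfc_mul (fun t : ℝ => (√t)⁻¹ * t) _ G (hcont.mul continuousOn_id) hcont,
          cfc_mul _ (fun t : ℝ => t) G hcont continuousOn_id,
          cfc_id' ℝ G hG.isHermitian.isSelfAdjoint, invSqrt]
    _ = cfc (fun _ : ℝ => (1 : ℝ)) G := cfc_congr fun t ht => by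
        rw [inv_mul_eq_div, ← div_eq_mul_inv, div_div, Real.mul_self_sqrt (spectrum_pos t ht).le,
          div_self (spectrum_pos t ht).ne']
    _ = 1 := cfc_const_one ℝ G hG.isHermitian.isSelfAdjoint

end InverseSquareRoot

section OrthonormalFamily

variable {ι E : Type*} [Fintype ι] [NormedAddCommGroup E] [InnerProductSpace ℝ E] {e : ι → E}

theorem norm_sum_smul_of_orthonormal (he : Orthonormal ℝ e) (a : ι → ℝ) :
    ‖∑ j, a j • e j‖ = ‖toLp 2 a‖ := by
  rw [← sq_eq_sq₀ (norm_nonneg _) (norm_nonneg _), ← dotProduct_self_eq_norm_sq,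
    ← real_inner_self_eq_norm_sq, he.inner_sum]
  rfl

theorem norm_starProjection_of_orthonormal (he : Orthonormal ℝ e) {U : Submodule ℝ E}
    [U.HasOrthogonalProjection] (hU : Submodule.span ℝ (Set.range e) = U) (y : E) :
    ‖U.starProjection y‖ = ‖toLp 2 fun j => inner ℝ (e j) y‖ := by
  have he' : Orthonormal ℝ fun j => (⟨e j, hU ▸ Submodule.subset_span ⟨j, rfl⟩⟩ : U) :=
    U.subtypeₗᵢ.orthonormal_comp_iff.1 he
  let b : OrthonormalBasis ι ℝ U :=
    .mk he' ((Submodule.span_range_subtype_eq_top_iff U _).2 hU).ge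
  have coe_b (j : ι) : (b j : E) = e j := by rw [OrthonormalBasis.coe_mk]
  rw [U.starProjection_apply, b.orthogonalProjectionOnto_apply_eq_sum]
  simp only [coe_b]
  exact norm_sum_smul_of_orthonormal b.orthonormal _

end OrthonormalFamily

section Series

variable {α ι : Type*} [Fintype ι]

/-- The linear combination of the functions `f j` with coefficients `c j`. -/
def series (f : ι → α → ℝ) (c : ι → ℝ) (x : α) : ℝ := ∑ j, f j x * c j

theorem series_sub (f : ι → α → ℝ) (c c' : ι → ℝ) (x : α) :
    series f (c - c') x = series f c x - series f c' x := by
  simp only [series, Pi.sub_apply, mul_sub, Finset.sum_sub_distrib]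

theorem measurable_series [MeasurableSpace α] {f : ι → α → ℝ} (hf : ∀ j, Measurable (f j))
    (c : ι → ℝ) : Measurable (series f c) :=
  Finset.measurable_sum _ fun j _ => (hf j).mul_const _

variable [MeasurableSpace α] {μ : Measure α} {f : ι → α → ℝ}

theorem memLp_series (hf : ∀ j, MemLp (f j) 2 μ) (c : ι → ℝ) : MemLp (series f c) 2 μ :=
  memLp_finsetSum _ fun j _ => (hf j).mul_const _

theorem toLp_series (hf : ∀ j, MemLp (f j) 2 μ) (c : ι → ℝ) :
    (memLp_series hf c).toLp _ = ∑ j, c j • (hf j).toLp (f j) := by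
  refine Lp.ext ?_
  have coe_smul : ∀ᵐ x ∂μ, ∀ j, (c j • (hf j).toLp (f j) : Lp ℝ 2 μ) x = f j x * c j :=
    ae_all_iff.2 fun j => by
      filter_upwards [Lp.coeFn_smul (c j) ((hf j).toLp (f j)), (hf j).coeFn_toLp] with x h₁ h₂
      rw [h₁, Pi.smul_apply, h₂, smul_eq_mul, mul_comm]
  filter_upwards [(memLp_series hf c).coeFn_toLp,
    Lp.coeFn_finsetSum Finset.univ fun j => c j • (hf j).toLp (f j), coe_smul] with x h₁ h₂ h₃
  rw [h₁, h₂, Finset.sum_apply]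
  exact Finset.sum_congr rfl fun j _ => (h₃ j).symm

theorem inner_toLp_toLp {f g : α → ℝ} (hf : MemLp f 2 μ) (hg : MemLp g 2 μ) :
    inner ℝ (hf.toLp f) (hg.toLp g) = ∫ x, f x * g x ∂μ := by
  rw [L2.inner_def]
  refine integral_congr_ae ?_
  filter_upwards [hf.coeFn_toLp, hg.coeFn_toLp] with x h₁ h₂
  rw [h₁, h₂, RCLike.inner_apply, conj_trivial, mul_comm]

end Series

section Whitening

variable {α : Type*} [MeasurableSpace α] {J : ℕ} {μ : Measure α} {ψ : Fin J → α → ℝ}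

/-- The components of `G^{-1/2} ψ(x)`, where `G = E[ψ(X) ψ(X)']`: an orthonormal basis of the sieve
space. -/
def whiten (μ : Measure α) (ψ : Fin J → α → ℝ) (j : Fin J) (x : α) : ℝ :=
  (invSqrt (gram μ ψ) *ᵥ fun k => ψ k x) j

theorem whiten_eq_series (μ : Measure α) (ψ : Fin J → α → ℝ) (j : Fin J) :
    whiten μ ψ j = series ψ (invSqrt (gram μ ψ) j) :=
  funext fun x => dotProduct_comm (invSqrt (gram μ ψ) j) fun k => ψ k x

theorem series_whiten (μ : Measure α) (ψ : Fin J → α → ℝ) (a : Fin J → ℝ) :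
    series (whiten μ ψ) a = series ψ (invSqrt (gram μ ψ) *ᵥ a) := by
  funext x
  change (invSqrt (gram μ ψ) *ᵥ fun k => ψ k x) ⬝ᵥ a = (fun k => ψ k x) ⬝ᵥ _
  rw [Matrix.dotProduct_mulVec, ← Matrix.mulVec_transpose, transpose_invSqrt]

theorem series_whiten_gram_mul_invSqrt (hG : (gram μ ψ).PosDef) (c : Fin J → ℝ) :
    series (whiten μ ψ) ((gram μ ψ * invSqrt (gram μ ψ)) *ᵥ c) = series ψ c := by
  rw [series_whiten, Matrix.mulVec_mulVec, ← Matrix.mul_assoc, invSqrt_mul_mul_invSqrt hG,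
    Matrix.one_mulVec]

theorem measurable_whiten (hψ : ∀ j, Measurable (ψ j)) (j : Fin J) :
    Measurable (whiten μ ψ j) := by
  rw [whiten_eq_series]
  exact measurable_series hψ _

theorem memLp_whiten (hψ : ∀ j, MemLp (ψ j) 2 μ) (j : Fin J) : MemLp (whiten μ ψ j) 2 μ := by
  rw [whiten_eq_series]
  exact memLp_series hψ _

theorem orthonormal_whiten (hψ : ∀ j, MemLp (ψ j) 2 μ) (hG : (gram μ ψ).PosDef) :
    Orthonormal ℝ fun j => (memLp_whiten hψ j).toLp (whiten μ ψ j) := by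
  refine orthonormal_iff_ite.2 fun j k => ?_
  have expand (j : Fin J) : (memLp_whiten hψ j).toLp (whiten μ ψ j) =
      ∑ l, invSqrt (gram μ ψ) j l • (hψ l).toLp (ψ l) := by
    rw [← toLp_series hψ]
    exact MemLp.toLp_congr _ _ (.of_eq (whiten_eq_series μ ψ j))
  rw [expand, expand, sum_inner, ← Matrix.one_apply, ← invSqrt_mul_mul_invSqrt hG,
    Matrix.mul_assoc, Matrix.mul_apply]
  refine Finset.sum_congr rfl fun l _ => ?_
  rw [inner_sum, Matrix.mul_apply, Finset.mul_sum]
  refine Finset.sum_congr rfl fun m _ => ?_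
  have symm : invSqrt (gram μ ψ) k m = invSqrt (gram μ ψ) m k :=
    congrFun₂ (transpose_invSqrt _) m k
  rw [real_inner_smul_left, real_inner_smul_right, inner_toLp_toLp, symm, gram, Matrix.of_apply,
    mul_comm (invSqrt _ m k)]

theorem mem_sieveSpace_iff (hψ : ∀ j, MemLp (ψ j) 2 μ) {h : Lp ℝ 2 μ} :
    h ∈ sieveSpace ψ hψ ↔ ∃ c, (memLp_series hψ c).toLp _ = h := by
  simp_rw [toLp_series hψ]
  exact Submodule.mem_span_range_iff_exists_fun ℝ

theorem sieveSpace_whiten (hψ : ∀ j, MemLp (ψ j) 2 μ) (hG : (gram μ ψ).PosDef) :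
    sieveSpace (whiten μ ψ) (memLp_whiten hψ) = sieveSpace ψ hψ := by
  ext h
  simp only [mem_sieveSpace_iff]
  constructor
  · rintro ⟨a, rfl⟩
    exact ⟨_, MemLp.toLp_congr _ _ (.of_eq (series_whiten μ ψ a).symm)⟩
  · rintro ⟨c, rfl⟩
    exact ⟨_, MemLp.toLp_congr _ _ (.of_eq (series_whiten_gram_mul_invSqrt hG c))⟩

theorem norm_toLp_series_whiten (hψ : ∀ j, MemLp (ψ j) 2 μ) (hG : (gram μ ψ).PosDef)
    (a : Fin J → ℝ) :
    ‖(memLp_series (memLp_whiten hψ) a).toLp _‖ = ‖toLp 2 a‖ := by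
  rw [toLp_series (memLp_whiten hψ), norm_sum_smul_of_orthonormal (orthonormal_whiten hψ hG)]

theorem norm_starProjection_sieveSpace (hψ : ∀ j, MemLp (ψ j) 2 μ) (hG : (gram μ ψ).PosDef)
    (y : Lp ℝ 2 μ) : ‖(sieveSpace ψ hψ).starProjection y‖ =
      ‖toLp 2 fun j => inner ℝ ((memLp_whiten hψ j).toLp (whiten μ ψ j)) y‖ :=
  norm_starProjection_of_orthonormal (orthonormal_whiten hψ hG) (sieveSpace_whiten hψ hG) y

theorem norm_whiten_le_zeta {s : Set α} (hs : zeta μ s ψ ≠ ⊤) {x : α} (hx : x ∈ s) :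
    ‖toLp 2 fun j => whiten μ ψ j x‖ ≤ (zeta μ s ψ).toReal := by
  rw [← ENNReal.ofReal_le_iff_le_toReal hs, ofReal_norm]
  exact le_iSup₂ (f := fun x _ => ‖toLp 2 (invSqrt (gram μ ψ) *ᵥ fun j => ψ j x)‖ₑ) x hx

end Whitening

section Design

variable {Ω α : Type*} [MeasurableSpace α] {J : ℕ}

theorem design_whiten (n : ℕ) (μ : Measure α) (ψ : Fin J → α → ℝ) (X : ℕ → Ω → α) (ω : Ω) :
    design n (whiten μ ψ) X ω = design n ψ X ω * invSqrt (gram μ ψ) := by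
  ext i j
  rw [design, Matrix.of_apply, whiten_eq_series]
  conv_rhs => rw [← transpose_invSqrt]
  rfl

theorem design_eq_design_whiten_mul (n : ℕ) {μ : Measure α} {ψ : Fin J → α → ℝ}
    (hG : (gram μ ψ).PosDef) (X : ℕ → Ω → α) (ω : Ω) :
    design n ψ X ω = design n (whiten μ ψ) X ω * (gram μ ψ * invSqrt (gram μ ψ)) := by
  rw [design_whiten, Matrix.mul_assoc, ← Matrix.mul_assoc (invSqrt _),
    invSqrt_mul_mul_invSqrt hG, Matrix.mul_one]

end Design

section ConditionalExpectation

variable {Ω : Type*} {m m₀ : MeasurableSpace Ω} {μ : Measure Ω} [IsFiniteMeasure μ]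
  {g u : Ω → ℝ}

theorem integral_mul_condExp (hm : m ≤ m₀) (hg : AEStronglyMeasurable[m] g μ)
    (hgu : Integrable (fun ω => g ω * u ω) μ) (hu : Integrable u μ) :
    ∫ ω, g ω * (μ[u | m]) ω ∂μ = ∫ ω, g ω * u ω ∂μ :=
  (integral_congr_ae (condExp_mul_of_aestronglyMeasurable_left hg hgu hu).symm).trans
    (integral_condExp hm)

theorem integral_mul_le_of_condExp_le (hm : m ≤ m₀) (hg : AEStronglyMeasurable[m] g μ)
    (hg₀ : 0 ≤ g) (hgi : Integrable g μ) (hgu : Integrable (fun ω => g ω * u ω) μ)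
    (hu : Integrable u μ) {c : ℝ} (hc : μ[u | m] ≤ᵐ[μ] fun _ => c) :
    ∫ ω, g ω * u ω ∂μ ≤ c * ∫ ω, g ω ∂μ := by
  rw [← integral_mul_condExp hm hg hgu hu, mul_comm, ← integral_mul_const]
  refine integral_mono_ae (integrable_condExp.congr
    (condExp_mul_of_aestronglyMeasurable_left hg hgu hu)) (hgi.mul_const c) ?_
  filter_upwards [hc] with ω hω using mul_le_mul_of_nonneg_left hω (hg₀ ω)

end ConditionalExpectation

section Operator

variable {Ω α β : Type*} [MeasurableSpace Ω] [MeasurableSpace α] [MeasurableSpace β]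
  [StandardBorelSpace α] [Nonempty α] {P : Measure Ω} [IsFiniteMeasure P] {X : Ω → α} {W : Ω → β}

theorem condExp_comp_ae_eq_condExpFun (hX : Measurable X) (hW : Measurable W) {f : α → ℝ}
    (hf : MemLp f 2 (P.map X)) :
    P[fun ω => f (X ω) | MeasurableSpace.comap W inferInstance]
      =ᵐ[P] fun ω => condExpFun P X W f (W ω) := by
  have hsnd : MeasurePreserving Prod.snd (P.map fun ω => (W ω, X ω)) (P.map X) :=
    ⟨measurable_snd, by rw [Measure.map_map measurable_snd (hW.prodMk hX)]; rfl⟩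
  exact condExp_prod_ae_eq_integral_condDistrib' hW hX.aemeasurable
    ((hf.comp_measurePreserving hsnd).integrable one_le_two)

theorem norm_condExpOp_le (hX : Measurable X) (hW : Measurable W) (h : Lp ℝ 2 (P.map X)) :
    ‖condExpOp P hX hW h‖ ≤ ‖h‖ := by
  rw [condExpOp, Lp.norm_toLp, Lp.norm_def]
  refine ENNReal.toReal_mono (Lp.eLpNorm_ne_top h) ?_
  rw [eLpNorm_map_measure (memLp_condExpFun P hX hW (Lp.memLp h)).1 hW.aemeasurable,
    eLpNorm_map_measure (Lp.memLp h).1 hX.aemeasurable]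
  calc eLpNorm (condExpFun P X W h ∘ W) 2 P
      = eLpNorm (P[fun ω => h (X ω) | MeasurableSpace.comap W inferInstance]) 2 P :=
        eLpNorm_congr_ae (condExp_comp_ae_eq_condExpFun hX hW (Lp.memLp h)).symm
    _ ≤ _ := eLpNorm_condExp_le_eLpNorm _ one_le_two

theorem inner_condExpOp (hX : Measurable X) (hW : Measurable W) {g : β → ℝ}
    (hg : MemLp g 2 (P.map W)) {f : α → ℝ} (hf : MemLp f 2 (P.map X)) :
    inner ℝ (hg.toLp g) (condExpOp P hX hW (hf.toLp f)) = ∫ ω, g (W ω) * f (X ω) ∂P := by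
  have hT := memLp_condExpFun P hX hW (Lp.memLp (hf.toLp f))
  have hfX : MemLp (fun ω => f (X ω)) 2 P := hf.comp_measurePreserving ⟨hX, rfl⟩
  have hgW : MemLp (fun ω => g (W ω)) 2 P := hg.comp_measurePreserving ⟨hW, rfl⟩
  have condExp_eq : P[fun ω => f (X ω) | MeasurableSpace.comap W inferInstance]
      =ᵐ[P] fun ω => condExpFun P X W (hf.toLp f) (W ω) :=
    (condExp_congr_ae (ae_eq_comp hX.aemeasurable hf.coeFn_toLp)).symm.trans
      (condExp_comp_ae_eq_condExpFun hX hW (Lp.memLp (hf.toLp f)))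
  calc inner ℝ (hg.toLp g) (condExpOp P hX hW (hf.toLp f))
      = ∫ ω, g (W ω) * condExpFun P X W (hf.toLp f) (W ω) ∂P := by
        rw [condExpOp, inner_toLp_toLp hg hT]
        exact integral_map hW.aemeasurable (hg.1.mul hT.1)
    _ = ∫ ω, g (W ω) * P[fun ω => f (X ω) | MeasurableSpace.comap W inferInstance] ω ∂P :=
        integral_congr_ae (condExp_eq.symm.mono fun ω hω => congrArg (g (W ω) * ·) hω)
    _ = ∫ ω, g (W ω) * f (X ω) ∂P :=
        integral_mul_condExp hW.comap_le (hg.1.comp_ae_measurable' hW.aemeasurable)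
          (hgW.integrable_mul hfX) (hfX.integrable one_le_two)

end Operator

section IllPosedness

variable {E F : Type*} [NormedAddCommGroup E] [NormedSpace ℝ E] [NormedAddCommGroup F]
  {T : E → F} {V : Submodule ℝ E} {x : E}

theorem enorm_div_enorm_le_illPosedness (hx : x ∈ V) (hx₀ : x ≠ 0) :
    ‖x‖ₑ / ‖T x‖ₑ ≤ illPosedness T V :=
  le_iSup₂_of_le (f := fun h _ => ⨆ _ : h ≠ 0, ‖h‖ₑ / ‖T h‖ₑ) x hx
    (le_iSup (fun _ : x ≠ 0 => ‖x‖ₑ / ‖T x‖ₑ) hx₀)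

theorem norm_le_illPosedness_mul (h : illPosedness T V ≠ ⊤) (hx : x ∈ V) :
    ‖x‖ ≤ (illPosedness T V).toReal * ‖T x‖ := by
  rcases eq_or_ne x 0 with rfl | hx₀
  · rw [norm_zero]
    positivity
  have ratio_le := enorm_div_enorm_le_illPosedness (T := T) hx hx₀
  have enorm_T_ne_zero : ‖T x‖ₑ ≠ 0 := fun h₀ =>
    h (top_le_iff.1 (by rwa [h₀, ENNReal.div_zero (enorm_ne_zero.2 hx₀)] at ratio_le))
  rw [ENNReal.div_le_iff enorm_T_ne_zero enorm_ne_top] at ratio_le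
  simpa only [ENNReal.toReal_mul, toReal_enorm] using
    ENNReal.toReal_mono (ENNReal.mul_ne_top h enorm_ne_top) ratio_le

theorem one_le_illPosedness (hx : x ∈ V) (hx₀ : x ≠ 0) (hT : ‖T x‖ ≤ ‖x‖) :
    1 ≤ illPosedness T V := by
  refine le_trans ?_ (enorm_div_enorm_le_illPosedness hx hx₀)
  rw [ENNReal.le_div_iff_mul_le (Or.inr (enorm_ne_zero.2 hx₀)) (Or.inl enorm_ne_top), one_mul]
  exact enorm_le_iff_norm_le.2 hT

theorem one_sub_le_illPosedness_mul_norm_starProjection {F : Type*} [NormedAddCommGroup F]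
    [InnerProductSpace ℝ F] {T : E → F} {U : Submodule ℝ F} [U.HasOrthogonalProjection]
    (h : illPosedness T V ≠ ⊤) {δ : ℝ≥0} (hδ : illPosedness T V * projectionGap T V U ≤ δ)
    (hx : x ∈ V) (hx₁ : ‖x‖ = 1) :
    1 - δ ≤ (illPosedness T V).toReal * ‖U.starProjection (T x)‖ := by
  have sub_le_gap : ‖U.starProjection (T x) - T x‖ₑ ≤ projectionGap T V U :=
    le_iSup₂_of_le (f := fun h _ => ⨆ _ : ‖h‖ = 1, ‖U.starProjection (T h) - T h‖ₑ) x hx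
      (le_iSup (fun _ : ‖x‖ = 1 => ‖U.starProjection (T x) - T x‖ₑ) hx₁)
  have scaled_sub_le : (illPosedness T V).toReal * ‖U.starProjection (T x) - T x‖ ≤ δ := by
    simpa only [ENNReal.toReal_mul, toReal_enorm, ENNReal.coe_toReal] using
      ENNReal.toReal_mono ENNReal.coe_ne_top ((mul_le_mul_right sub_le_gap _).trans hδ)
  calc 1 - δ ≤ (illPosedness T V).toReal * ‖T x‖ -
          (illPosedness T V).toReal * ‖U.starProjection (T x) - T x‖ :=
        sub_le_sub (hx₁.symm.trans_le (norm_le_illPosedness_mul h hx)) scaled_sub_le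
    _ ≤ (illPosedness T V).toReal * ‖U.starProjection (T x)‖ := by
        rw [← mul_sub]
        gcongr
        rw [norm_sub_rev]
        linarith [norm_sub_norm_le (T x) (U.starProjection (T x))]

end IllPosedness

section MatrixNorm

theorem norm_toLp_sumElim_sq {m n : Type*} [Fintype m] [Fintype n] (a : m → ℝ) (b : n → ℝ) :
    ‖toLp 2 (Sum.elim a b)‖ ^ 2 = ‖toLp 2 a‖ ^ 2 + ‖toLp 2 b‖ ^ 2 := by
  simp only [← dotProduct_self_eq_norm_sq, sumElim_dotProduct_sumElim]

theorem norm_le_of_forall_norm_mulVec_le {m n : Type*} [Fintype m] [Fintype n] [DecidableEq n]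
    {A : Matrix m n ℝ} {C : ℝ} (hC : 0 ≤ C) (h : ∀ v, ‖toLp 2 (A *ᵥ v)‖ ≤ C * ‖toLp 2 v‖) :
    ‖A‖ ≤ C :=
  ContinuousLinearMap.opNorm_le_bound _ hC fun x => h x.ofLp

variable {l m n o : Type*} [Fintype l] [Fintype m]

theorem norm_one_submatrix_le_one [DecidableEq m] {e : l → m} (he : e.Injective) :
    ‖(1 : Matrix m m ℝ).submatrix e id‖ ≤ 1 := by
  classical
  have gram_eq : (1 : Matrix m m ℝ).submatrix e id * ((1 : Matrix m m ℝ).submatrix e id)ᴴ = 1 := by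
    rw [conjTranspose_submatrix, conjTranspose_one, ← submatrix_mul _ _ _ _ _ Function.bijective_id,
      Matrix.one_mul, submatrix_one _ he]
  have norm_sq := l2_opNorm_conjTranspose_mul_self ((1 : Matrix m m ℝ).submatrix e id)ᴴ
  rw [conjTranspose_conjTranspose, gram_eq, l2_opNorm_conjTranspose] at norm_sq
  nlinarith [(IsStarProjection.one (R := Matrix l l ℝ)).norm_le]

theorem norm_submatrix_le [Fintype n] [Fintype o] [DecidableEq n] [DecidableEq o] (A : Matrix m n ℝ)
    {e : l → m} {f : o → n} (he : e.Injective) (hf : f.Injective) : ‖A.submatrix e f‖ ≤ ‖A‖ := by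
  classical
  have factor : A.submatrix e f =
      (1 : Matrix m m ℝ).submatrix e id * A * ((1 : Matrix n n ℝ).submatrix f id)ᴴ := by
    rw [conjTranspose_submatrix, conjTranspose_one]
    nth_rw 2 [← submatrix_id_id A]
    rw [← submatrix_mul _ _ _ _ _ Function.bijective_id,
      ← submatrix_mul _ _ _ _ _ Function.bijective_id, Matrix.one_mul, Matrix.mul_one]
  calc ‖A.submatrix e f‖ ≤ ‖(1 : Matrix m m ℝ).submatrix e id‖ * ‖A‖ *
          ‖(1 : Matrix n n ℝ).submatrix f id‖ := by
        rw [factor, ← l2_opNorm_conjTranspose ((1 : Matrix n n ℝ).submatrix f id)]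
        exact (l2_opNorm_mul _ _).trans (by gcongr; exact l2_opNorm_mul _ _)
    _ ≤ 1 * ‖A‖ * 1 := by gcongr <;> exact norm_one_submatrix_le_one ‹_›
    _ = ‖A‖ := by rw [one_mul, mul_one]

variable [DecidableEq m]

theorem norm_vecMulVec_self_le (c : m → ℝ) : ‖vecMulVec c c‖ ≤ ‖toLp 2 c‖ ^ 2 := by
  refine norm_le_of_forall_norm_mulVec_le (sq_nonneg _) fun v => ?_
  calc ‖toLp 2 (vecMulVec c c *ᵥ v)‖ = |c ⬝ᵥ v| * ‖toLp 2 c‖ := by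
        rw [vecMulVec_mulVec, op_smul_eq_smul, WithLp.toLp_smul, norm_smul, Real.norm_eq_abs]
    _ ≤ ‖toLp 2 c‖ * ‖toLp 2 v‖ * ‖toLp 2 c‖ := by
        gcongr
        exact abs_dotProduct_le_norm_mul_norm c v
    _ = ‖toLp 2 c‖ ^ 2 * ‖toLp 2 v‖ := by ring

variable {E : Type*} [NormedAddCommGroup E] [InnerProductSpace ℝ E]

theorem norm_gram_le {v : m → E} {C : ℝ} (hC : 0 ≤ C)
    (h : ∀ a : m → ℝ, ‖∑ j, a j • v j‖ ≤ C * ‖toLp 2 a‖) : ‖Matrix.gram ℝ v‖ ≤ C ^ 2 := by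
  refine norm_le_of_forall_norm_mulVec_le (sq_nonneg C) fun a => ?_
  set w := Matrix.gram ℝ v *ᵥ a
  have norm_sq_le : ‖toLp 2 w‖ * ‖toLp 2 w‖ ≤ ‖toLp 2 w‖ * (C ^ 2 * ‖toLp 2 a‖) :=
    calc ‖toLp 2 w‖ * ‖toLp 2 w‖ = inner ℝ (∑ j, w j • v j) (∑ j, a j • v j) := by
          rw [← sq, ← dotProduct_self_eq_norm_sq, ← Matrix.star_dotProduct_gram_mulVec]
          rfl
      _ ≤ C * ‖toLp 2 w‖ * (C * ‖toLp 2 a‖) :=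
          (real_inner_le_norm _ _).trans (by gcongr <;> exact h _)
      _ = ‖toLp 2 w‖ * (C ^ 2 * ‖toLp 2 a‖) := by ring
  rcases (norm_nonneg (toLp 2 w)).eq_or_lt with h₀ | h₀
  · rw [← h₀]
    positivity
  · exact le_of_mul_le_mul_left norm_sq_le h₀

theorem norm_gram_sumElim_le_two [Fintype n] [DecidableEq n] {e : m → E} {e' : n → E}
    (he : Orthonormal ℝ e) (he' : Orthonormal ℝ e') : ‖Matrix.gram ℝ (Sum.elim e e')‖ ≤ 2 := by
  refine (norm_gram_le (Real.sqrt_nonneg 2) fun a => ?_).trans_eq (Real.sq_sqrt zero_le_two)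
  obtain ⟨a, b, rfl⟩ : ∃ b c, a = Sum.elim b c := ⟨_, _, (Sum.elim_comp_inl_inr a).symm⟩
  refine (sq_le_sq₀ (norm_nonneg _) (by positivity)).1 ?_
  rw [mul_pow, Real.sq_sqrt zero_le_two, norm_toLp_sumElim_sq, Fintype.sum_sum_type]
  calc ‖∑ j, a j • e j + ∑ j, b j • e' j‖ ^ 2 ≤ (‖toLp 2 a‖ + ‖toLp 2 b‖) ^ 2 := by
        rw [← norm_sum_smul_of_orthonormal he, ← norm_sum_smul_of_orthonormal he']
        gcongr
        exact norm_add_le _ _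
    _ ≤ 2 * (‖toLp 2 a‖ ^ 2 + ‖toLp 2 b‖ ^ 2) := add_sq_le

end MatrixNorm

section SecondMoments

variable {S : Type*} [MeasurableSpace S] {ν : Measure S} {κ ι : Type*}

/-- The rank one matrix `φ(s) φ(s)'` of a family `φ` of functions. -/
def outerProduct (φ : ι → S → ℝ) (s : S) : Matrix ι ι ℝ :=
  vecMulVec (fun j => φ j s) fun j => φ j s

/-- The matrix `E[f(s) g(s)']` of mixed second moments; `gram` is the case `f = g`. -/
def crossMoment (ν : Measure S) (f : κ → S → ℝ) (g : ι → S → ℝ) : Matrix κ ι ℝ :=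
  of fun k j => ∫ s, f k s * g j s ∂ν

theorem crossMoment_self_eq_gram {φ : ι → S → ℝ} (hφ : ∀ j, MemLp (φ j) 2 ν) :
    crossMoment ν φ φ = Matrix.gram ℝ fun j => (hφ j).toLp (φ j) := by
  ext j k
  rw [Matrix.gram_apply, inner_toLp_toLp (hφ j) (hφ k)]
  rfl

theorem crossMoment_self_eq_one [DecidableEq ι] {φ : ι → S → ℝ}
    {hφ : ∀ j, MemLp (φ j) 2 ν}
    (h : Orthonormal ℝ fun j => (hφ j).toLp (φ j)) : crossMoment ν φ φ = 1 := by
  ext j k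
  rw [crossMoment_self_eq_gram hφ, Matrix.gram_apply, orthonormal_iff_ite.1 h, one_apply]

variable [Fintype κ] [Fintype ι] [DecidableEq κ] [DecidableEq ι]

theorem memLp_outerProduct [IsFiniteMeasure ν] {φ : ι → S → ℝ}
    (hφ : ∀ j, AEStronglyMeasurable (φ j) ν) {r : ℝ} (hr : ∀ᵐ s ∂ν, ‖outerProduct φ s‖ ≤ r) :
    MemLp (outerProduct φ) ∞ ν := by
  have measurable_vec : AEStronglyMeasurable (fun s j => φ j s) ν :=
    (aemeasurable_pi_iff.2 fun j => (hφ j).aemeasurable).aestronglyMeasurable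
  exact memLp_top_of_bound ((continuous_id.matrix_vecMulVec continuous_id).comp_aestronglyMeasurable
    measurable_vec) r hr

theorem integral_outerProduct {φ : ι → S → ℝ} (h : Integrable (outerProduct φ) ν) :
    ∫ s, outerProduct φ s ∂ν = crossMoment ν φ φ := by
  ext j k
  exact ((LinearMap.toContinuousLinearMap
    (Matrix.entryLinearMap ℝ ℝ j k)).integral_comp_comm h).symm

theorem norm_crossMoment_sumElim_le_two {f : κ → S → ℝ} {g : ι → S → ℝ}
    {hf : ∀ k, MemLp (f k) 2 ν} {hg : ∀ j, MemLp (g j) 2 ν}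
    (hf₁ : Orthonormal ℝ fun k => (hf k).toLp (f k))
    (hg₁ : Orthonormal ℝ fun j => (hg j).toLp (g j)) :
    ‖crossMoment ν (Sum.elim f g) (Sum.elim f g)‖ ≤ 2 := by
  have memLp_sumElim : ∀ a, MemLp (Sum.elim f g a) 2 ν := Sum.rec hf hg
  convert norm_gram_sumElim_le_two hf₁ hg₁
  rw [crossMoment_self_eq_gram memLp_sumElim]
  congr 1
  ext1 a
  cases a <;> rfl

theorem norm_outerProduct_sumElim_le {S : Type*} {f : κ → S → ℝ} {g : ι → S → ℝ} {ζ : ℝ} {s : S}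
    (hf : ‖toLp 2 fun k => f k s‖ ≤ ζ) (hg : ‖toLp 2 fun j => g j s‖ ≤ ζ) :
    ‖outerProduct (Sum.elim f g) s‖ ≤ 2 * ζ ^ 2 := by
  have split : (fun a => Sum.elim f g a s) = Sum.elim (fun k => f k s) fun j => g j s := by
    ext a
    cases a <;> rfl
  calc ‖outerProduct (Sum.elim f g) s‖
    _ ≤ ‖toLp 2 fun a => Sum.elim f g a s‖ ^ 2 := norm_vecMulVec_self_le _
    _ = ‖toLp 2 fun k => f k s‖ ^ 2 + ‖toLp 2 fun j => g j s‖ ^ 2 := by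
      rw [split, norm_toLp_sumElim_sq]
    _ ≤ 2 * ζ ^ 2 := by rw [two_mul]; gcongr

theorem centeredSum_outerProduct_submatrix {φ : ι → S → ℝ} (h : Integrable (outerProduct φ) ν)
    {n : ℕ} (z : Fin n → S) {l o : Type*} (e : l → ι) (e' : o → ι) :
    (centeredSum ν (outerProduct φ) z).submatrix e e' =
      (of fun i a => φ (e a) (z i))ᵀ * (of fun i b => φ (e' b) (z i)) -
        (n : ℝ) • crossMoment ν (φ ∘ e) (φ ∘ e') := by
  ext a b
  rw [centeredSum_eq, integral_outerProduct h, ← Nat.cast_smul_eq_nsmul ℝ]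
  simp only [submatrix_apply, Matrix.sub_apply, Matrix.sum_apply, Matrix.smul_apply, mul_apply]
  rfl

variable [IsProbabilityMeasure ν] {f : κ → S → ℝ} {g : ι → S → ℝ} {hf : ∀ k, MemLp (f k) 2 ν}
  {hg : ∀ j, MemLp (g j) 2 ν} {ζ : ℝ}

theorem memLp_outerProduct_sumElim (hf : ∀ k, MemLp (f k) 2 ν) (hg : ∀ j, MemLp (g j) 2 ν)
    (hfζ : ∀ᵐ s ∂ν, ‖toLp 2 fun k => f k s‖ ≤ ζ) (hgζ : ∀ᵐ s ∂ν, ‖toLp 2 fun j => g j s‖ ≤ ζ) :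
    MemLp (outerProduct (Sum.elim f g)) ∞ ν := by
  refine memLp_outerProduct (Sum.rec (fun k => (hf k).1) fun j => (hg j).1) (r := 2 * ζ ^ 2) ?_
  filter_upwards [hfζ, hgζ] with s using norm_outerProduct_sumElim_le

theorem measure_norm_centeredSum_outerProduct_gt_le
    (hf₁ : Orthonormal ℝ fun k => (hf k).toLp (f k))
    (hg₁ : Orthonormal ℝ fun j => (hg j).toLp (g j))
    (hfζ : ∀ᵐ s ∂ν, ‖toLp 2 fun k => f k s‖ ≤ ζ) (hgζ : ∀ᵐ s ∂ν, ‖toLp 2 fun j => g j s‖ ≤ ζ)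
    {n p : ℕ} (hp : p ≠ 0) (hlog : Real.log (Fintype.card κ + Fintype.card ι) ≤ p) {t : ℝ}
    (ht : 0 < t) :
    (sampleLaw ν n).real {z : Fin n → S | t < ‖centeredSum ν (outerProduct (Sum.elim f g)) z‖} ≤
      Real.exp 1 * (((4 * p * ζ ^ 2) ^ 2 + 8 * n * (4 * p * ζ ^ 2)) / t ^ 2) := by
  have memLp_top := memLp_outerProduct_sumElim hf hg hfζ hgζ
  have bound : ∀ᵐ s ∂ν, ‖outerProduct (Sum.elim f g) s‖ ≤ 2 * ζ ^ 2 := by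
    filter_upwards [hfζ, hgζ] with s using norm_outerProduct_sumElim_le
  have norm_mean : ‖∫ s, outerProduct (Sum.elim f g) s ∂ν‖ ≤ 2 := by
    rw [integral_outerProduct (memLp_top.integrable le_top)]
    exact norm_crossMoment_sumElim_le_two hf₁ hg₁
  refine (measure_norm_centeredSum_gt_le memLp_top (fun s => ?_) (by positivity) bound norm_mean
    hp (by rwa [Fintype.card_sum, Nat.cast_add]) ht).trans_eq (by ring)
  exact posSemidef_vecMulVec_self_star fun a => Sum.elim f g a s

end SecondMoments

section VectorMoments

variable {S E : Type*} [MeasurableSpace S] [NormedAddCommGroup E] [InnerProductSpace ℝ E]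

theorem eLpNorm_two_eq_ofReal_sqrt {E : Type*} [NormedAddCommGroup E] {μ : Measure S} {f : S → E}
    (hf : MemLp f 2 μ) :
    eLpNorm f 2 μ = ENNReal.ofReal √(∫ s, ‖f s‖ ^ 2 ∂μ) := by
  rw [hf.eLpNorm_eq_integral_rpow_norm two_ne_zero ENNReal.ofNat_ne_top, Real.sqrt_eq_rpow]
  simp

variable [CompleteSpace E] {ν : Measure S} [IsProbabilityMeasure ν] {V : S → E}

theorem integral_norm_sub_integral_sq_le (hV : MemLp V 2 ν) :
    ∫ s, ‖V s - ∫ t, V t ∂ν‖ ^ 2 ∂ν ≤ ∫ s, ‖V s‖ ^ 2 ∂ν := by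
  set m := ∫ t, V t ∂ν
  have hV₁ : Integrable V ν := hV.integrable one_le_two
  have inner_mean : ∫ s, inner ℝ (V s) m ∂ν = ‖m‖ ^ 2 := by
    simp_rw [real_inner_comm m]
    rw [integral_inner hV₁, real_inner_self_eq_norm_sq]
  have h₁ : Integrable (fun s => ‖V s‖ ^ 2) ν := hV.integrable_norm_pow two_ne_zero
  have h₂ : Integrable (fun s => 2 * inner ℝ (V s) m) ν := (hV₁.inner_const m).const_mul 2
  have h₁₂ : Integrable (fun s => ‖V s‖ ^ 2 - 2 * inner ℝ (V s) m) ν := h₁.sub h₂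
  simp_rw [norm_sub_sq_real]
  rw [integral_add h₁₂ (integrable_const _), integral_sub h₁ h₂, integral_const_mul,
    inner_mean, integral_const, probReal_univ, one_smul]
  linarith [sq_nonneg ‖m‖]

theorem integral_inner_eval_eq_zero (hV : Integrable V ν) (h₀ : ∫ s, V s ∂ν = 0) {n : ℕ}
    {i j : Fin n} (hij : i ≠ j) : ∫ z, inner ℝ (V (z i)) (V (z j)) ∂sampleLaw ν n = 0 := by
  have eval (k : Fin n) : MeasurePreserving (Function.eval k) (sampleLaw ν n) ν :=
    measurePreserving_eval (fun _ => ν) k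
  have indep : IndepFun (Function.eval i) (Function.eval j) (sampleLaw ν n) :=
    (iIndepFun_pi fun _ => aemeasurable_id).indepFun hij
  have factor := indep.integral_bilin_comp_comp (eval i).aemeasurable (eval j).aemeasurable
    ((eval i).map_eq.symm ▸ hV) ((eval j).map_eq.symm ▸ hV) (innerSL ℝ)
  rwa [integral_comp_measurePreserving (eval i) hV.1, h₀, map_zero] at factor

theorem integral_norm_centeredSum_sq (hV : MemLp V 2 ν) (n : ℕ) :
    ∫ z : Fin n → S, ‖centeredSum ν V z‖ ^ 2 ∂sampleLaw ν n =
      n * ∫ s, ‖V s - ∫ t, V t ∂ν‖ ^ 2 ∂ν := by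
  set D : S → E := fun s => V s - ∫ t, V t ∂ν
  have hD : MemLp D 2 ν := hV.sub (memLp_const _)
  have mean_zero : ∫ s, D s ∂ν = 0 := by
    rw [integral_sub (hV.integrable one_le_two) (integrable_const _), integral_const,
      probReal_univ, one_smul, sub_self]
  have diagonal (i : Fin n) : ∫ z, inner ℝ (D (z i)) (D (z i)) ∂sampleLaw ν n =
      ∫ s, ‖D s‖ ^ 2 ∂ν := by
    simp_rw [real_inner_self_eq_norm_sq]
    exact integral_comp_measurePreserving (measurePreserving_eval (fun _ => ν) i)
      (hD.integrable_norm_pow two_ne_zero).1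
  have integrable (i j : Fin n) :
      Integrable (fun z => inner ℝ (D (z i)) (D (z j))) (sampleLaw ν n) :=
    memLp_one_iff_integrable.1
      ((innerSL ℝ).memLp_of_bilin 1 (memLp_eval_sample hD i) (memLp_eval_sample hD j))
  calc ∫ z : Fin n → S, ‖centeredSum ν V z‖ ^ 2 ∂sampleLaw ν n
    _ = ∫ z, ∑ i, ∑ j, inner ℝ (D (z i)) (D (z j)) ∂sampleLaw ν n := by
      simp_rw [← real_inner_self_eq_norm_sq, centeredSum, sum_inner, inner_sum]
      rfl
    _ = ∑ i, ∑ j, ∫ z, inner ℝ (D (z i)) (D (z j)) ∂sampleLaw ν n := by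
      rw [integral_finsetSum _ fun i _ => integrable_finsetSum _ fun j _ => integrable i j]
      exact Finset.sum_congr rfl fun i _ => integral_finsetSum _ fun j _ => integrable i j
    _ = ∑ _i : Fin n, ∫ s, ‖D s‖ ^ 2 ∂ν := by
      refine Finset.sum_congr rfl fun i _ => ?_
      rw [Finset.sum_eq_single_of_mem i (Finset.mem_univ i) fun j _ hj =>
        integral_inner_eval_eq_zero (hD.integrable one_le_two) mean_zero hj.symm, diagonal]
    _ = n * ∫ s, ‖D s‖ ^ 2 ∂ν := by
      rw [Finset.sum_const, Finset.card_univ, Fintype.card_fin, nsmul_eq_mul]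

theorem eLpNorm_centeredSum_le (hV : MemLp V 2 ν) (n : ℕ) :
    eLpNorm (centeredSum ν V : (Fin n → S) → E) 2 (sampleLaw ν n) ≤
      ENNReal.ofReal √n * eLpNorm V 2 ν := by
  rw [eLpNorm_two_eq_ofReal_sqrt (memLp_centeredSum hV n), eLpNorm_two_eq_ofReal_sqrt hV,
    ← ENNReal.ofReal_mul (Real.sqrt_nonneg _), ← Real.sqrt_mul n.cast_nonneg,
    integral_norm_centeredSum_sq hV]
  exact ENNReal.ofReal_le_ofReal (Real.sqrt_le_sqrt
    (mul_le_mul_of_nonneg_left (integral_norm_sub_integral_sq_le hV) n.cast_nonneg))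

theorem eLpNorm_smul_sum_le (hV : MemLp V 2 ν) {n : ℕ} (hn : 0 < n) (c : ℝ) :
    eLpNorm (fun z : Fin n → S => (c / n) • ∑ i, V (z i)) 2 (sampleLaw ν n) ≤
      ‖c‖ₑ * (‖∫ s, V s ∂ν‖ₑ + ENNReal.ofReal (√n)⁻¹ * eLpNorm V 2 ν) := by
  have hn' : (0 : ℝ) < n := Nat.cast_pos.2 hn
  have split : (fun z : Fin n → S => (c / n) • ∑ i, V (z i)) =
      c • ((fun _ => ∫ s, V s ∂ν) + (n : ℝ)⁻¹ • centeredSum ν V) := by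
    ext1 z
    rw [Pi.smul_apply, Pi.add_apply, Pi.smul_apply, centeredSum_eq, smul_sub,
      ← Nat.cast_smul_eq_nsmul ℝ, inv_smul_smul₀ hn'.ne', add_sub_cancel, smul_smul, div_eq_mul_inv]
  rw [split, eLpNorm_const_smul]
  gcongr
  refine (eLpNorm_add_le aestronglyMeasurable_const
    ((memLp_centeredSum hV n).1.const_smul _) one_le_two).trans ?_
  rw [eLpNorm_const _ two_ne_zero (IsProbabilityMeasure.ne_zero _), measure_univ, ENNReal.one_rpow,
    mul_one, eLpNorm_const_smul]
  refine add_le_add le_rfl ?_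
  calc ‖(n : ℝ)⁻¹‖ₑ * eLpNorm (centeredSum ν V) 2 (sampleLaw ν n)
    _ ≤ ENNReal.ofReal (n : ℝ)⁻¹ * (ENNReal.ofReal √n * eLpNorm V 2 ν) := by
      rw [Real.enorm_of_nonneg (inv_nonneg.2 hn'.le)]
      gcongr
      exact eLpNorm_centeredSum_le hV n
    _ = ENNReal.ofReal (√n)⁻¹ * eLpNorm V 2 ν := by
      rw [← mul_assoc, ← ENNReal.ofReal_mul (inv_nonneg.2 hn'.le), inv_mul_eq_div,
        Real.sqrt_div_self]

end VectorMoments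

section Obs

variable {S ι : Type*} [MeasurableSpace S] {ν : Measure S}

theorem crossMoment_mulVec {κ : Type*} [Fintype ι] {f : κ → S → ℝ} {g : ι → S → ℝ}
    (hf : ∀ k, MemLp (f k) 2 ν) (hg : ∀ j, MemLp (g j) 2 ν) (q : ι → ℝ) (k : κ) :
    (crossMoment ν f g *ᵥ q) k = ∫ s, f k s * series g q s ∂ν := by
  simp_rw [series, Finset.mul_sum, ← mul_assoc]
  have integrable (j : ι) : Integrable (fun s => f k s * g j s * q j) ν :=
    ((hf k).integrable_mul (hg j)).mul_const _
  rw [integral_finsetSum _ fun j _ => integrable j]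
  exact Finset.sum_congr rfl fun j _ => (integral_mul_const _ _).symm

theorem orthonormal_toLp_comp_measurePreserving {α : Type*} [MeasurableSpace α] {μ : Measure α}
    {φ : S → α} (hφ : MeasurePreserving φ ν μ) {f : ι → α → ℝ} (hf : ∀ j, MemLp (f j) 2 μ)
    (h : Orthonormal ℝ fun j => (hf j).toLp (f j)) :
    Orthonormal ℝ fun j => ((hf j).comp_measurePreserving hφ).toLp (f j ∘ φ) :=
  h.comp_linearIsometry (Lp.compMeasurePreservingₗᵢ ℝ φ hφ)

theorem pos_of_orthonormal_of_ae_norm_le [Fintype ι] [Nonempty ι] {f : ι → S → ℝ}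
    {hf : ∀ j, MemLp (f j) 2 ν} (h : Orthonormal ℝ fun j => (hf j).toLp (f j)) {ζ : ℝ}
    (hζ : ∀ᵐ s ∂ν, ‖toLp 2 fun j => f j s‖ ≤ ζ) : 0 < ζ := by
  by_contra! hζ₀
  obtain ⟨j⟩ := ‹Nonempty ι›
  refine h.ne_zero j ((MemLp.toLp_congr (hf j) MemLp.zero' ?_).trans (MemLp.toLp_zero _))
  filter_upwards [hζ] with s hs
  exact congrFun (congrArg WithLp.ofLp (norm_le_zero_iff.1 (hs.trans hζ₀))) j

end Obs

namespace Setting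

/-- The space of the observations `(Y, X, W)`. -/
abbrev Observation (d dw : ℕ) : Type := ℝ × EuclideanSpace ℝ (Fin d) × EuclideanSpace ℝ (Fin dw)

variable {Ω : Type*} [MeasurableSpace Ω] {P : Measure Ω} {d dw : ℕ} (M : Setting P d dw)

/-- The observation `(Y i, X i, W i)`. -/
def obs (i : ℕ) (ω : Ω) : Observation d dw := (M.Y i ω, M.X i ω, M.W i ω)

/-- The law of an observation. -/
abbrev lawObs : Measure (Observation d dw) := P.map (M.obs 0)

/-- The orthonormalized instruments `G_b^{-1/2} b^K(W)`, as functions of the observation. -/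
def instr (n : ℕ) (k : Fin (M.K n)) (s : Observation d dw) : ℝ :=
  whiten M.lawW (M.b (M.K n)) k s.2.2

/-- The orthonormalized regressors `G_ψ^{-1/2} ψ^J(X)`, as functions of the observation. -/
def regr (n : ℕ) (j : Fin (M.J n)) (s : Observation d dw) : ℝ :=
  whiten M.lawX (M.ψ (M.J n)) j s.2.1

theorem measurable_obs (i : ℕ) : Measurable (M.obs i) :=
  (M.sample.measurable_Y i).prodMk ((M.sample.measurable_X i).prodMk (M.sample.measurable_W i))

theorem measurePreserving_X : MeasurePreserving (fun s => s.2.1) M.lawObs M.lawX :=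
  ⟨by fun_prop, by rw [Measure.map_map (by fun_prop) (M.measurable_obs 0)]; rfl⟩

theorem measurePreserving_W : MeasurePreserving (fun s => s.2.2) M.lawObs M.lawW :=
  ⟨by fun_prop, by rw [Measure.map_map (by fun_prop) (M.measurable_obs 0)]; rfl⟩

instance [IsProbabilityMeasure P] : IsProbabilityMeasure M.lawObs :=
  Measure.isProbabilityMeasure_map (M.measurable_obs 0).aemeasurable

theorem measurePreserving_sample [IsProbabilityMeasure P] (n : ℕ) :
    MeasurePreserving (fun ω (i : Fin n) => M.obs i ω) P (sampleLaw M.lawObs n) := by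
  have indep : iIndepFun (fun i : Fin n => M.obs i) P := M.sample.indep.precomp Fin.val_injective
  refine ⟨measurable_pi_lambda _ fun i => M.measurable_obs i, ?_⟩
  rw [(iIndepFun_iff_map_fun_eq_pi_map fun i => (M.measurable_obs _).aemeasurable).1 indep]
  exact congrArg Measure.pi (funext fun i => (M.sample.ident i).map_eq)

theorem memLp_instr (n : ℕ) (k : Fin (M.K n)) : MemLp (M.instr n k) 2 M.lawObs :=
  (memLp_whiten (M.memLp_b _) k).comp_measurePreserving M.measurePreserving_W

theorem memLp_regr (n : ℕ) (j : Fin (M.J n)) : MemLp (M.regr n j) 2 M.lawObs :=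
  (memLp_whiten (M.memLp_ψ _) j).comp_measurePreserving M.measurePreserving_X

theorem orthonormal_instr (n : ℕ) :
    Orthonormal ℝ fun k => (M.memLp_instr n k).toLp (M.instr n k) :=
  orthonormal_toLp_comp_measurePreserving M.measurePreserving_W _
    (orthonormal_whiten (M.memLp_b _) (M.gram_b_posDef n))

theorem orthonormal_regr (n : ℕ) :
    Orthonormal ℝ fun j => (M.memLp_regr n j).toLp (M.regr n j) :=
  orthonormal_toLp_comp_measurePreserving M.measurePreserving_X _
    (orthonormal_whiten (M.memLp_ψ _) (M.gram_ψ_posDef n))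

theorem measurable_instr (n : ℕ) (k : Fin (M.K n)) : Measurable (M.instr n k) :=
  (measurable_whiten (M.measurable_b _) k).comp M.measurePreserving_W.measurable

theorem measurable_regr (n : ℕ) (j : Fin (M.J n)) : Measurable (M.regr n j) :=
  (measurable_whiten (M.measurable_ψ _) j).comp M.measurePreserving_X.measurable

theorem ae_norm_instr_le {n : ℕ} (h : M.zetaMax n ≠ ⊤) :
    ∀ᵐ s ∂M.lawObs, ‖toLp 2 fun k => M.instr n k s‖ ≤ (M.zetaMax n).toReal := by
  have hle : zeta M.lawW M.suppW (M.b (M.K n)) ≤ M.zetaMax n := le_max_left _ _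
  have hmeas : Measurable fun s => ‖toLp 2 fun k => M.instr n k s‖ :=
    ((WithLp.measurable_toLp 2 _).comp (measurable_pi_lambda _ (M.measurable_instr n))).norm
  rw [ae_map_iff (M.measurable_obs 0).aemeasurable (measurableSet_le hmeas measurable_const)]
  filter_upwards [M.mem_suppW 0] with ω hω
  exact (norm_whiten_le_zeta (ne_top_of_le_ne_top h hle) hω).trans (ENNReal.toReal_mono h hle)

theorem ae_norm_regr_le {n : ℕ} (h : M.zetaMax n ≠ ⊤) :
    ∀ᵐ s ∂M.lawObs, ‖toLp 2 fun j => M.regr n j s‖ ≤ (M.zetaMax n).toReal := by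
  have hle : zeta M.lawX M.suppX (M.ψ (M.J n)) ≤ M.zetaMax n := le_max_right _ _
  have hmeas : Measurable fun s => ‖toLp 2 fun j => M.regr n j s‖ :=
    ((WithLp.measurable_toLp 2 _).comp (measurable_pi_lambda _ (M.measurable_regr n))).norm
  rw [ae_map_iff (M.measurable_obs 0).aemeasurable (measurableSet_le hmeas measurable_const)]
  filter_upwards [M.mem_suppX 0] with ω hω
  exact (norm_whiten_le_zeta (ne_top_of_le_ne_top h hle) hω).trans (ENNReal.toReal_mono h hle)

theorem zetaMax_ne_zero {n : ℕ} (hJ : 0 < M.J n) : M.zetaMax n ≠ 0 := by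
  intro h₀
  have : Nonempty (Fin (M.J n)) := ⟨⟨0, hJ⟩⟩
  have hpos := pos_of_orthonormal_of_ae_norm_le (M.orthonormal_regr n)
    (M.ae_norm_regr_le (h₀ ▸ ENNReal.zero_ne_top))
  simp [h₀] at hpos

section Operator

variable [IsProbabilityMeasure P]

theorem norm_T_le (h : Lp ℝ 2 M.lawX) : ‖M.T h‖ ≤ ‖h‖ := norm_condExpOp_le _ _ h

theorem inner_T {g : EuclideanSpace ℝ (Fin dw) → ℝ} {f : EuclideanSpace ℝ (Fin d) → ℝ}
    (hg : MemLp g 2 M.lawW) (hf : MemLp f 2 M.lawX) :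
    inner ℝ (hg.toLp g) (M.T (hf.toLp f)) = ∫ s, g s.2.2 * f s.2.1 ∂M.lawObs := by
  rw [T, inner_condExpOp, integral_map (M.measurable_obs 0).aemeasurable]
  · rfl
  · exact ((hg.comp_measurePreserving M.measurePreserving_W).integrable_mul
      (hf.comp_measurePreserving M.measurePreserving_X)).1

theorem norm_starProjection_T (n : ℕ) {f : EuclideanSpace ℝ (Fin d) → ℝ}
    (hf : MemLp f 2 M.lawX) :
    ‖(M.sieveW n).starProjection (M.T (hf.toLp f))‖ =
      ‖toLp 2 fun k => ∫ s, M.instr n k s * f s.2.1 ∂M.lawObs‖ := by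
  refine (norm_starProjection_sieveSpace (M.memLp_b _) (M.gram_b_posDef n) _).trans ?_
  simp_rw [M.inner_T]
  rfl

theorem one_le_tau {n : ℕ} (hJ : 0 < M.J n) : 1 ≤ M.tau n := by
  have ne_zero := (orthonormal_whiten (M.memLp_ψ _) (M.gram_ψ_posDef n)).ne_zero ⟨0, hJ⟩
  refine one_le_illPosedness ?_ ne_zero (M.norm_T_le _)
  rw [sieveX, ← sieveSpace_whiten (M.memLp_ψ _) (M.gram_ψ_posDef n)]
  exact Submodule.subset_span ⟨_, rfl⟩

theorem norm_le_tau_mul_norm_crossMoment {n : ℕ} (hτ : M.tau n ≠ ⊤) {δ : ℝ≥0}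
    (hgap : M.tau n * projectionGap M.T (M.sieveX n) (M.sieveW n) ≤ δ) (q : Fin (M.J n) → ℝ) :
    (1 - δ) * ‖toLp 2 q‖ ≤
      (M.tau n).toReal * ‖toLp 2 (crossMoment M.lawObs (M.instr n) (M.regr n) *ᵥ q)‖ := by
  wlog hq : ‖toLp 2 q‖ = 1 generalizing q
  · rcases eq_or_ne (toLp 2 q) 0 with h₀ | h₀
    · rw [h₀, norm_zero, mul_zero]
      positivity
    have hpos : 0 < ‖toLp 2 q‖ := norm_pos_iff.2 h₀
    have unit : ‖toLp 2 (‖toLp 2 q‖⁻¹ • q)‖ = 1 := by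
      rw [WithLp.toLp_smul, norm_smul, norm_inv, norm_norm, inv_mul_cancel₀ hpos.ne']
    have scaled := this _ unit
    rw [unit, mul_one, Matrix.mulVec_smul, WithLp.toLp_smul, norm_smul, norm_inv, norm_norm,
      mul_left_comm, le_inv_mul_iff₀ hpos] at scaled
    rwa [mul_comm]
  have hψ := memLp_whiten (M.memLp_ψ (M.J n))
  have mem : (memLp_series hψ q).toLp _ ∈ M.sieveX n := by
    rw [sieveX, ← sieveSpace_whiten (M.memLp_ψ _) (M.gram_ψ_posDef n)]
    exact (mem_sieveSpace_iff _).2 ⟨q, rfl⟩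
  have norm_eq_one : ‖(memLp_series hψ q).toLp _‖ = 1 :=
    (norm_toLp_series_whiten (M.memLp_ψ _) (M.gram_ψ_posDef n) q).trans hq
  have cross : (crossMoment M.lawObs (M.instr n) (M.regr n) *ᵥ q) =
      fun k => ∫ s, M.instr n k s * series (whiten M.lawX (M.ψ (M.J n))) q s.2.1 ∂M.lawObs :=
    funext fun k => crossMoment_mulVec (M.memLp_instr n) (M.memLp_regr n) q k
  rw [hq, mul_one, cross, ← M.norm_starProjection_T n (memLp_series hψ q)]
  exact one_sub_le_illPosedness_mul_norm_starProjection hτ hgap mem norm_eq_one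

end Operator

end Setting

namespace Setting

variable {Ω : Type*} [MeasurableSpace Ω] {P : Measure Ω} {d dw : ℕ} (M : Setting P d dw)

section Residual

theorem exists_series_eq_starProjection (n : ℕ) : ∃ c : Fin (M.J n) → ℝ,
    (memLp_series (M.memLp_ψ (M.J n)) c).toLp _ = (M.sieveX n).starProjection M.h₀L :=
  (mem_sieveSpace_iff _).1 (Submodule.starProjection_apply_mem (M.sieveX n) M.h₀L)

/-- The coefficients of `Π_J h₀` in the basis `ψ^J`. -/
def projCoef (n : ℕ) : Fin (M.J n) → ℝ := (M.exists_series_eq_starProjection n).choose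

/-- The function `h₀ - Π_J h₀`, a representative of `approxError`. -/
def resid (n : ℕ) (x : EuclideanSpace ℝ (Fin d)) : ℝ :=
  M.h₀ x - series (M.ψ (M.J n)) (M.projCoef n) x

theorem memLp_resid (n : ℕ) : MemLp (M.resid n) 2 M.lawX :=
  M.sample.memLp_h₀.sub (memLp_series (M.memLp_ψ _) _)

theorem toLp_resid (n : ℕ) : (M.memLp_resid n).toLp (M.resid n) = M.approxError n := by
  rw [approxError, ← (M.exists_series_eq_starProjection n).choose_spec]
  exact MemLp.toLp_sub M.sample.memLp_h₀ (memLp_series (M.memLp_ψ _) _)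

end Residual

section Moment

/-- The product of the vector of orthonormalized instruments with a function `q` of the
observation. -/
def moment (n : ℕ) (q : Observation d dw → ℝ) (s : Observation d dw) :
    EuclideanSpace ℝ (Fin (M.K n)) :=
  toLp 2 fun k => M.instr n k s * q s

/-- The sample mean of `moment n q`, scaled by `τ_J`. -/
def weightedMoment [IsFiniteMeasure P] (n : ℕ) (q : Observation d dw → ℝ) (ω : Ω) :
    EuclideanSpace ℝ (Fin (M.K n)) :=
  ((M.tau n).toReal / n) • ∑ i : Fin n, M.moment n q (M.obs i ω)

theorem weightedMoment_add [IsFiniteMeasure P] (n : ℕ) (q q' : Observation d dw → ℝ) (ω : Ω) :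
    M.weightedMoment n (q + q') ω = M.weightedMoment n q ω + M.weightedMoment n q' ω := by
  have moment_add (s : Observation d dw) :
      M.moment n (q + q') s = M.moment n q s + M.moment n q' s := by
    ext k
    exact mul_add _ _ _
  simp_rw [weightedMoment, moment_add, Finset.sum_add_distrib, smul_add]

theorem toLp_transpose_mulVec_eq_sum_moment (n : ℕ) (q : Observation d dw → ℝ) (ω : Ω) :
    toLp 2 ((design n (whiten M.lawW (M.b (M.K n))) M.W ω)ᵀ *ᵥ fun i => q (M.obs i ω)) =
      ∑ i : Fin n, M.moment n q (M.obs i ω) := by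
  ext k
  rw [WithLp.ofLp_sum, Finset.sum_apply]
  rfl

end Moment

variable [IsProbabilityMeasure P]

/-- The sample size `n` is large enough for the error bound of the fit to apply; this holds
eventually, see `eventually_isRegularAt`. -/
structure IsRegularAt (n : ℕ) : Prop where
  pos : 0 < n
  J_pos : 0 < M.J n
  tau_mul_zetaMax_le : M.tau n * M.zetaMax n * ENNReal.ofReal (√n)⁻¹ ≤ 1
  gap_le : M.tau n * projectionGap M.T (M.sieveX n) (M.sieveW n) ≤ (4⁻¹ : ℝ≥0)

/-- The event on which the empirical second moments of the orthonormalized bases are within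
`1 / (8 τ_J)` of their expectations, in the operator norm. -/
def goodEvent (n : ℕ) : Set Ω :=
  {ω | ‖centeredSum M.lawObs (outerProduct (Sum.elim (M.instr n) (M.regr n)))
    fun i : Fin n => M.obs i ω‖ ≤ n / (8 * (M.tau n).toReal)}

variable {M} {n : ℕ}

namespace IsRegularAt

theorem tau_ne_top (h : M.IsRegularAt n) : M.tau n ≠ ⊤ := by
  intro hτ
  have hn : ENNReal.ofReal (√n)⁻¹ ≠ 0 :=
    (ENNReal.ofReal_pos.2 (inv_pos.2 (Real.sqrt_pos.2 (Nat.cast_pos.2 h.pos)))).ne'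
  have := h.tau_mul_zetaMax_le
  rw [hτ, ENNReal.top_mul (M.zetaMax_ne_zero h.J_pos), ENNReal.top_mul hn] at this
  exact ENNReal.one_ne_top (top_le_iff.1 this)

theorem zetaMax_ne_top (h : M.IsRegularAt n) : M.zetaMax n ≠ ⊤ := by
  intro hζ
  have hn : ENNReal.ofReal (√n)⁻¹ ≠ 0 :=
    (ENNReal.ofReal_pos.2 (inv_pos.2 (Real.sqrt_pos.2 (Nat.cast_pos.2 h.pos)))).ne'
  have := h.tau_mul_zetaMax_le
  rw [hζ, ENNReal.mul_top (one_pos.trans_le (M.one_le_tau h.J_pos)).ne', ENNReal.top_mul hn] at this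
  exact ENNReal.one_ne_top (top_le_iff.1 this)

theorem one_le_toReal_tau (h : M.IsRegularAt n) : 1 ≤ (M.tau n).toReal :=
  ENNReal.toReal_mono h.tau_ne_top (M.one_le_tau h.J_pos)

theorem three_quarters_mul_norm_le (h : M.IsRegularAt n) (q : Fin (M.J n) → ℝ) :
    3 / 4 * ‖toLp 2 q‖ ≤
      (M.tau n).toReal * ‖toLp 2 (crossMoment M.lawObs (M.instr n) (M.regr n) *ᵥ q)‖ := by
  refine le_of_eq_of_le ?_ (M.norm_le_tau_mul_norm_crossMoment h.tau_ne_top h.gap_le q)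
  norm_num

end IsRegularAt

theorem integrable_outerProduct_sumElim (h : M.zetaMax n ≠ ⊤) :
    Integrable (outerProduct (Sum.elim (M.instr n) (M.regr n))) M.lawObs :=
  (memLp_outerProduct_sumElim (M.memLp_instr n) (M.memLp_regr n) (M.ae_norm_instr_le h)
    (M.ae_norm_regr_le h)).integrable le_top

theorem norm_instr_gram_sub_le (h : M.zetaMax n ≠ ⊤) {ω : Ω} (hω : ω ∈ M.goodEvent n) :
    ‖(design n (whiten M.lawW (M.b (M.K n))) M.W ω)ᵀ *
        design n (whiten M.lawW (M.b (M.K n))) M.W ω - (n : ℝ) • 1‖ ≤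
      n / (8 * (M.tau n).toReal) := by
  have block := centeredSum_outerProduct_submatrix (integrable_outerProduct_sumElim h)
    (fun i : Fin n => M.obs i ω) Sum.inl Sum.inl
  rw [Sum.elim_comp_inl, crossMoment_self_eq_one (M.orthonormal_instr n)] at block
  refine le_of_eq_of_le (congrArg _ block.symm) ((norm_submatrix_le _ ?_ ?_).trans hω)
  exacts [Sum.inl_injective, Sum.inl_injective]

theorem norm_crossMoment_sub_le (h : M.zetaMax n ≠ ⊤) {ω : Ω} (hω : ω ∈ M.goodEvent n) :
    ‖(design n (whiten M.lawW (M.b (M.K n))) M.W ω)ᵀ *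
        design n (whiten M.lawX (M.ψ (M.J n))) M.X ω -
        (n : ℝ) • crossMoment M.lawObs (M.instr n) (M.regr n)‖ ≤
      n / (8 * (M.tau n).toReal) := by
  have block := centeredSum_outerProduct_submatrix (integrable_outerProduct_sumElim h)
    (fun i : Fin n => M.obs i ω) Sum.inl Sum.inr
  rw [Sum.elim_comp_inl, Sum.elim_comp_inr] at block
  refine le_of_eq_of_le (congrArg _ block.symm) ((norm_submatrix_le _ ?_ ?_).trans hω)
  exacts [Sum.inl_injective, Sum.inr_injective]

theorem IsRegularAt.norm_mulVec_tslsCoef_sub_projCoef_le (h : M.IsRegularAt n) {ω : Ω}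
    (hω : ω ∈ M.goodEvent n) {Z : ℕ → Ω → ℝ} {q : Observation d dw → ℝ}
    (hZ : ∀ i, Z i ω = series (M.ψ (M.J n)) (M.projCoef n) (M.X i ω) + q (M.obs i ω)) :
    ‖toLp 2 ((gram M.lawX (M.ψ (M.J n)) * invSqrt (gram M.lawX (M.ψ (M.J n)))) *ᵥ
        (tslsCoef M.ginv (design n (M.ψ (M.J n)) M.X ω) (design n (M.b (M.K n)) M.W ω)
          (fun i => Z i ω) - M.projCoef n))‖ ≤
      4 * ‖M.weightedMoment n q ω‖ := by
  have error : (fun i : Fin n => Z i ω) - design n (M.ψ (M.J n)) M.X ω *ᵥ M.projCoef n =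
      fun i : Fin n => q (M.obs i ω) :=
    funext fun i => (congrArg (· - _) (hZ i)).trans (add_sub_cancel_left _ _)
  have bound := norm_mulVec_tslsCoef_sub_le M.isGeneralizedInverse
    (design_whiten n M.lawW (M.b (M.K n)) M.W ω)
    (design_eq_design_whiten_mul n (M.gram_b_posDef n) M.W ω)
    (design_eq_design_whiten_mul n (M.gram_ψ_posDef n) M.X ω) h.one_le_toReal_tau
    h.three_quarters_mul_norm_le (norm_instr_gram_sub_le h.zetaMax_ne_top hω)
    (norm_crossMoment_sub_le h.zetaMax_ne_top hω) h.pos (fun i => Z i ω) (M.projCoef n)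
  rw [error, M.toLp_transpose_mulVec_eq_sum_moment] at bound
  refine bound.trans_eq ?_
  rw [weightedMoment, norm_smul, Real.norm_of_nonneg (by positivity), mul_div_assoc, mul_assoc]

theorem IsRegularAt.eLpNorm_sieveFit_sub_le (h : M.IsRegularAt n) {ω : Ω}
    (hω : ω ∈ M.goodEvent n) {Z : ℕ → Ω → ℝ} {q : Observation d dw → ℝ}
    (hZ : ∀ i, Z i ω = series (M.ψ (M.J n)) (M.projCoef n) (M.X i ω) + q (M.obs i ω)) :
    eLpNorm (fun x => sieveFit M.ginv n (M.ψ (M.J n)) (M.b (M.K n)) Z M.X M.W ω x - M.h₀ x) 2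
      M.lawX ≤ 4 * ‖M.weightedMoment n q ω‖ₑ + ‖M.approxError n‖ₑ := by
  set a := tslsCoef M.ginv (design n (M.ψ (M.J n)) M.X ω) (design n (M.b (M.K n)) M.W ω)
    (fun i => Z i ω)
  have hψ := memLp_whiten (M.memLp_ψ (M.J n))
  have split : (fun x => sieveFit M.ginv n (M.ψ (M.J n)) (M.b (M.K n)) Z M.X M.W ω x - M.h₀ x) =
      series (whiten M.lawX (M.ψ (M.J n))) ((gram M.lawX (M.ψ (M.J n)) *
        invSqrt (gram M.lawX (M.ψ (M.J n)))) *ᵥ (a - M.projCoef n)) - M.resid n := by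
    ext x
    rw [series_whiten_gram_mul_invSqrt (M.gram_ψ_posDef n), Pi.sub_apply, series_sub, resid,
      sub_sub_sub_cancel_right]
    rfl
  rw [split]
  refine (eLpNorm_sub_le (memLp_series hψ _).1 (M.memLp_resid n).1 one_le_two).trans ?_
  rw [← Lp.enorm_toLp (memLp_series hψ _), ← Lp.enorm_toLp (M.memLp_resid n), M.toLp_resid]
  refine add_le_add ?_ le_rfl
  rw [← ofReal_norm, norm_toLp_series_whiten (M.memLp_ψ _) (M.gram_ψ_posDef n)]
  refine (ENNReal.ofReal_le_ofReal (h.norm_mulVec_tslsCoef_sub_projCoef_le hω hZ)).trans_eq ?_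
  rw [ENNReal.ofReal_mul zero_le_four, ofReal_norm, ENNReal.ofReal_ofNat]

end Setting

theorem sqrt_log_two_mul_inv_sqrt_le {J n : ℕ} (hJ : 2 ≤ J) :
    √(Real.log 2) * (√n)⁻¹ ≤ √(Real.log J / n) := by
  rw [← div_eq_mul_inv, ← Real.sqrt_div (Real.log_nonneg one_le_two)]
  gcongr
  exact_mod_cast hJ

namespace Setting

variable {Ω : Type*} [MeasurableSpace Ω] {P : Measure Ω} {d dw : ℕ} (M : Setting P d dw)

theorem exists_eventually_ceil_log_le :
    ∃ L : ℝ, ∀ᶠ n in atTop, (⌈Real.log (M.K n + M.J n)⌉₊ : ℝ) ≤ L * Real.log (M.J n) := by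
  obtain ⟨C, hC₀, hC⟩ := M.K_isBigO.exists_nonneg
  refine ⟨(Real.log (C + 1) + 1) / Real.log 2 + 1, ?_⟩
  filter_upwards [hC.bound, M.eventually_two_le_J] with n hK hJ
  have hJ' : (2 : ℝ) ≤ M.J n := by exact_mod_cast hJ
  rw [Real.norm_natCast, Real.norm_natCast] at hK
  have log_two_pos : 0 < Real.log 2 := Real.log_pos one_lt_two
  have log_two_le : Real.log 2 ≤ Real.log (M.J n) := Real.log_le_log two_pos hJ'
  have log_nonneg : 0 ≤ Real.log (M.K n + M.J n) :=
    Real.log_nonneg (by linarith [(M.K n).cast_nonneg (α := ℝ)])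
  have const_nonneg : 0 ≤ Real.log (C + 1) + 1 :=
    add_nonneg (Real.log_nonneg (by linarith)) zero_le_one
  calc (⌈Real.log (M.K n + M.J n)⌉₊ : ℝ)
    _ ≤ Real.log (M.K n + M.J n) + 1 := (Nat.ceil_lt_add_one log_nonneg).le
    _ ≤ Real.log ((C + 1) * M.J n) + 1 := by
        gcongr
        linarith
    _ = (Real.log (C + 1) + 1) / Real.log 2 * Real.log 2 + Real.log (M.J n) := by
        rw [Real.log_mul (by positivity) (by positivity), div_mul_cancel₀ _ log_two_pos.ne']
        ring
    _ ≤ ((Real.log (C + 1) + 1) / Real.log 2 + 1) * Real.log (M.J n) := by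
        rw [add_mul, one_mul]
        gcongr

variable [IsProbabilityMeasure P]

theorem eventually_isRegularAt
    (hgap : Tendsto (fun n => M.tau n * projectionGap M.T (M.sieveX n) (M.sieveW n)) atTop (𝓝 0))
    (hrate : Tendsto (fun n : ℕ => M.tau n * M.zetaMax n *
      ENNReal.ofReal √(Real.log (M.J n) / n)) atTop (𝓝 0)) :
    ∀ᶠ n in atTop, M.IsRegularAt n := by
  have log_two_pos : 0 < ENNReal.ofReal √(Real.log 2) :=
    ENNReal.ofReal_pos.2 (Real.sqrt_pos.2 (Real.log_pos one_lt_two))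
  have quarter_pos : (0 : ℝ≥0∞) < (4⁻¹ : ℝ≥0) := ENNReal.coe_pos.2 (by positivity)
  filter_upwards [eventually_gt_atTop 0, M.eventually_two_le_J,
    hrate.eventually (ge_mem_nhds log_two_pos), hgap.eventually (ge_mem_nhds quarter_pos)]
    with n hn hJ small gap_le
  refine ⟨hn, two_pos.trans_le hJ, ?_, gap_le⟩
  refine (ENNReal.mul_le_mul_iff_right log_two_pos.ne' ENNReal.ofReal_ne_top).1 ?_
  calc ENNReal.ofReal √(Real.log 2) * (M.tau n * M.zetaMax n * ENNReal.ofReal (√n)⁻¹)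
    _ = M.tau n * M.zetaMax n * ENNReal.ofReal (√(Real.log 2) * (√n)⁻¹) := by
        rw [ENNReal.ofReal_mul (Real.sqrt_nonneg _), mul_left_comm]
    _ ≤ M.tau n * M.zetaMax n * ENNReal.ofReal √(Real.log (M.J n) / n) := by
        gcongr
        exact sqrt_log_two_mul_inv_sqrt_le hJ
    _ ≤ ENNReal.ofReal √(Real.log 2) * 1 := small.trans_eq (mul_one _).symm

variable {M} in
theorem IsRegularAt.measureReal_compl_goodEvent_le {n : ℕ} (h : M.IsRegularAt n) {p : ℕ}
    (hp : p ≠ 0) (hlog : Real.log (M.K n + M.J n) ≤ p) {x : ℝ}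
    (hx : ((M.tau n).toReal * (M.zetaMax n).toReal) ^ 2 * (p / n) ≤ x) :
    P.real (M.goodEvent n)ᶜ ≤ Real.exp 1 * (1024 * x ^ 2 + 2048 * x) := by
  set τ := (M.tau n).toReal
  set ζ := (M.zetaMax n).toReal
  have hτ : 1 ≤ τ := h.one_le_toReal_tau
  have hn : (0 : ℝ) < n := Nat.cast_pos.2 h.pos
  have memLp := memLp_outerProduct_sumElim (M.memLp_instr n) (M.memLp_regr n)
    (M.ae_norm_instr_le h.zetaMax_ne_top) (M.ae_norm_regr_le h.zetaMax_ne_top)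
  have null : NullMeasurableSet {z : Fin n → Observation d dw | n / (8 * τ) <
      ‖centeredSum M.lawObs (outerProduct (Sum.elim (M.instr n) (M.regr n))) z‖}
      (sampleLaw M.lawObs n) :=
    nullMeasurableSet_lt aemeasurable_const (memLp_centeredSum memLp n).1.norm.aemeasurable
  have compl : (M.goodEvent n)ᶜ = (fun ω (i : Fin n) => M.obs i ω) ⁻¹'
      {z | n / (8 * τ) <
        ‖centeredSum M.lawObs (outerProduct (Sum.elim (M.instr n) (M.regr n))) z‖} := by
    ext ω
    exact not_le (α := ℝ)
  rw [compl, measureReal_def, (M.measurePreserving_sample n).measure_preimage null]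
  refine (measure_norm_centeredSum_outerProduct_gt_le (M.orthonormal_instr n) (M.orthonormal_regr n)
    (M.ae_norm_instr_le h.zetaMax_ne_top) (M.ae_norm_regr_le h.zetaMax_ne_top) hp
    (by simpa only [Fintype.card_fin] using hlog) (by positivity)).trans ?_
  have : 0 ≤ (τ * ζ) ^ 2 * (p / n) := by positivity
  calc Real.exp 1 * (((4 * p * ζ ^ 2) ^ 2 + 8 * n * (4 * p * ζ ^ 2)) / (n / (8 * τ)) ^ 2)
    _ = Real.exp 1 * (1024 * (τ * (ζ ^ 2 * (p / n))) ^ 2 + 2048 * ((τ * ζ) ^ 2 * (p / n))) := by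
        field_simp
        ring
    _ ≤ Real.exp 1 * (1024 * (τ ^ 2 * (ζ ^ 2 * (p / n))) ^ 2 +
          2048 * ((τ * ζ) ^ 2 * (p / n))) := by
        gcongr
        exact le_self_pow₀ hτ two_ne_zero
    _ ≤ Real.exp 1 * (1024 * x ^ 2 + 2048 * x) := by
        rw [← mul_assoc, ← mul_pow]
        gcongr

theorem tendsto_measure_compl_goodEvent
    (hgap : Tendsto (fun n => M.tau n * projectionGap M.T (M.sieveX n) (M.sieveW n)) atTop (𝓝 0))
    (hrate : Tendsto (fun n : ℕ => M.tau n * M.zetaMax n *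
      ENNReal.ofReal √(Real.log (M.J n) / n)) atTop (𝓝 0)) :
    Tendsto (fun n => P (M.goodEvent n)ᶜ) atTop (𝓝 0) := by
  obtain ⟨L, hL⟩ := M.exists_eventually_ceil_log_le
  have rate_sq : Tendsto (fun n : ℕ => ((M.tau n).toReal * (M.zetaMax n).toReal) ^ 2 *
      (Real.log (M.J n) / n)) atTop (𝓝 0) := by
    have := ((ENNReal.tendsto_toReal ENNReal.zero_ne_top).comp hrate).pow 2
    rw [ENNReal.toReal_zero, zero_pow two_ne_zero] at this
    refine this.congr fun n => ?_
    rw [Function.comp_apply, ENNReal.toReal_mul, ENNReal.toReal_mul,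
      ENNReal.toReal_ofReal (Real.sqrt_nonneg _), mul_pow, Real.sq_sqrt (by positivity)]
  have bound_tendsto : Tendsto (fun n : ℕ => Real.exp 1 *
      (1024 * (L * (((M.tau n).toReal * (M.zetaMax n).toReal) ^ 2 *
        (Real.log (M.J n) / n))) ^ 2 +
      2048 * (L * (((M.tau n).toReal * (M.zetaMax n).toReal) ^ 2 *
        (Real.log (M.J n) / n))))) atTop (𝓝 0) := by
    have lim := rate_sq.const_mul L
    have := (((lim.pow 2).const_mul 1024).add (lim.const_mul 2048)).const_mul (Real.exp 1)
    simpa only [mul_zero, ne_eq, OfNat.ofNat_ne_zero, not_false_eq_true, zero_pow, add_zero]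
      using this
  refine (ENNReal.tendsto_toReal_iff (fun _ => measure_ne_top _ _) ENNReal.zero_ne_top).1 ?_
  refine squeeze_zero' (.of_forall fun _ => ENNReal.toReal_nonneg) ?_ bound_tendsto
  filter_upwards [M.eventually_isRegularAt hgap hrate, hL, M.eventually_two_le_J]
    with n hreg hceil hJ
  have log_pos : 0 < Real.log (M.K n + M.J n) := by
    have hJ' : (2 : ℝ) ≤ M.J n := by exact_mod_cast hJ
    exact Real.log_pos (by linarith [(M.K n).cast_nonneg (α := ℝ)])
  refine hreg.measureReal_compl_goodEvent_le (Nat.ceil_pos.2 log_pos).ne' (Nat.le_ceil _) ?_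
  rw [mul_left_comm, ← mul_div_assoc L]
  gcongr

end Setting

theorem memLp_smul_sum_eval_sample {S E : Type*} [MeasurableSpace S] [NormedAddCommGroup E]
    [NormedSpace ℝ E] {ν : Measure S} [IsProbabilityMeasure ν] {V : S → E} (hV : MemLp V 2 ν)
    (n : ℕ) (c : ℝ) : MemLp (fun z : Fin n → S => c • ∑ i, V (z i)) 2 (sampleLaw ν n) :=
  (memLp_finsetSum _ fun i _ => memLp_eval_sample hV i).const_smul c

namespace Setting

variable {Ω : Type*} [MeasurableSpace Ω] {P : Measure Ω} {d dw : ℕ} {M : Setting P d dw} {n : ℕ}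
  {q : Observation d dw → ℝ}

section Envelope

theorem ae_norm_moment_le (h : M.zetaMax n ≠ ⊤) (q : Observation d dw → ℝ) :
    ∀ᵐ s ∂M.lawObs, ‖M.moment n q s‖ ≤ (M.zetaMax n).toReal * ‖q s‖ := by
  filter_upwards [M.ae_norm_instr_le h] with s hs
  have moment_eq : M.moment n q s = q s • toLp 2 fun k => M.instr n k s := by
    ext k
    exact mul_comm _ _
  rw [moment_eq, norm_smul, mul_comm]
  gcongr

theorem eLpNorm_moment_le (h : M.zetaMax n ≠ ⊤) (q : Observation d dw → ℝ) :
    eLpNorm (M.moment n q) 2 M.lawObs ≤ M.zetaMax n * eLpNorm q 2 M.lawObs :=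
  (eLpNorm_le_mul_eLpNorm_of_ae_le_mul (ae_norm_moment_le h q) 2).trans_eq
    (by rw [ENNReal.ofReal_toReal h])

theorem memLp_moment (h : M.zetaMax n ≠ ⊤) (hq : MemLp q 2 M.lawObs) :
    MemLp (M.moment n q) 2 M.lawObs := by
  refine hq.of_le_mul (AEMeasurable.aestronglyMeasurable ?_) (ae_norm_moment_le h q)
  exact (WithLp.measurable_toLp 2 _).comp_aemeasurable (aemeasurable_pi_lambda _ fun k =>
    (M.measurable_instr n k).aemeasurable.mul hq.1.aemeasurable)

end Envelope

section Sample

variable [IsProbabilityMeasure P]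

theorem integral_moment (hq : MemLp (M.moment n q) 2 M.lawObs) :
    ∫ s, M.moment n q s ∂M.lawObs = toLp 2 fun k => ∫ s, M.instr n k s * q s ∂M.lawObs := by
  ext k
  exact eval_integral_piLp (hq.integrable one_le_two).eval_piLp k

theorem weightedMoment_eq_comp (M : Setting P d dw) (n : ℕ) (q : Observation d dw → ℝ) :
    M.weightedMoment n q = (fun z : Fin n → Observation d dw =>
      ((M.tau n).toReal / n) • ∑ i, M.moment n q (z i)) ∘ fun ω i => M.obs i ω := rfl

theorem memLp_weightedMoment (hq : MemLp (M.moment n q) 2 M.lawObs) :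
    MemLp (M.weightedMoment n q) 2 P := by
  rw [weightedMoment_eq_comp]
  exact (memLp_smul_sum_eval_sample hq n _).comp_measurePreserving (M.measurePreserving_sample n)

theorem eLpNorm_weightedMoment_le (hn : 0 < n) (hq : MemLp (M.moment n q) 2 M.lawObs) :
    eLpNorm (M.weightedMoment n q) 2 P ≤ M.tau n * (‖∫ s, M.moment n q s ∂M.lawObs‖ₑ +
      ENNReal.ofReal (√n)⁻¹ * eLpNorm (M.moment n q) 2 M.lawObs) := by
  have enorm_tau_le : ‖(M.tau n).toReal‖ₑ ≤ M.tau n := by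
    rw [Real.enorm_of_nonneg ENNReal.toReal_nonneg]
    exact ENNReal.ofReal_toReal_le
  rw [weightedMoment_eq_comp, eLpNorm_comp_measurePreserving
    (memLp_smul_sum_eval_sample hq n _).1 (M.measurePreserving_sample n)]
  refine (eLpNorm_smul_sum_le hq hn _).trans ?_
  gcongr

end Sample

section Residual

theorem memLp_resid_obs (M : Setting P d dw) (n : ℕ) :
    MemLp (fun s => M.resid n s.2.1) 2 M.lawObs :=
  (M.memLp_resid n).comp_measurePreserving M.measurePreserving_X

variable [IsProbabilityMeasure P]

theorem norm_integral_moment_resid_le (h : M.zetaMax n ≠ ⊤) :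
    ‖∫ s, M.moment n (fun s => M.resid n s.2.1) s ∂M.lawObs‖ ≤ ‖M.T (M.approxError n)‖ := by
  rw [integral_moment (memLp_moment h (M.memLp_resid_obs n)),
    ← M.norm_starProjection_T n (M.memLp_resid n), M.toLp_resid]
  exact Submodule.norm_starProjection_apply_le _ _

theorem IsRegularAt.eLpNorm_weightedMoment_resid_le (h : M.IsRegularAt n) {C : ℝ≥0}
    (hC : M.tau n * ‖M.T (M.approxError n)‖ₑ ≤ C * ‖M.approxError n‖ₑ) :
    eLpNorm (M.weightedMoment n fun s => M.resid n s.2.1) 2 P ≤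
      (C + 1 : ℝ≥0) * ‖M.approxError n‖ₑ := by
  have memLp := memLp_moment h.zetaMax_ne_top (M.memLp_resid_obs n)
  have eLpNorm_resid : eLpNorm (fun s : Observation d dw => M.resid n s.2.1) 2 M.lawObs =
      ‖M.approxError n‖ₑ := by
    have transfer := eLpNorm_comp_measurePreserving (p := 2) (M.memLp_resid n).1
      M.measurePreserving_X
    exact transfer.trans (M.toLp_resid n ▸ (Lp.enorm_toLp (M.memLp_resid n)).symm)
  calc eLpNorm (M.weightedMoment n fun s => M.resid n s.2.1) 2 P
    _ ≤ M.tau n * (‖M.T (M.approxError n)‖ₑ +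
          ENNReal.ofReal (√n)⁻¹ * (M.zetaMax n * ‖M.approxError n‖ₑ)) := by
        refine (eLpNorm_weightedMoment_le h.pos memLp).trans ?_
        gcongr
        · exact enorm_le_iff_norm_le.2 (norm_integral_moment_resid_le h.zetaMax_ne_top)
        · exact eLpNorm_resid ▸ eLpNorm_moment_le h.zetaMax_ne_top _
    _ = M.tau n * ‖M.T (M.approxError n)‖ₑ +
          M.tau n * M.zetaMax n * ENNReal.ofReal (√n)⁻¹ * ‖M.approxError n‖ₑ := by ring
    _ ≤ C * ‖M.approxError n‖ₑ + 1 * ‖M.approxError n‖ₑ := by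
        gcongr
        exact h.tau_mul_zetaMax_le
    _ = (C + 1 : ℝ≥0) * ‖M.approxError n‖ₑ := by
        rw [← add_mul, ENNReal.coe_add, ENNReal.coe_one]

end Residual

section Noise

variable (M) in
/-- The error `u = Y - h₀(X)`, as a function of the observation. -/
def noise (s : Observation d dw) : ℝ := s.1 - M.h₀ s.2.1

theorem measurable_noise : Measurable M.noise :=
  measurable_fst.sub (M.sample.measurable_h₀.comp (by fun_prop))

theorem memLp_noise (hu : MemLp (fun ω => M.Y 0 ω - M.h₀ (M.X 0 ω)) 2 P) :
    MemLp M.noise 2 M.lawObs :=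
  (memLp_map_measure_iff measurable_noise.aestronglyMeasurable
    (M.measurable_obs 0).aemeasurable).2 hu

theorem aestronglyMeasurable_instr_obs (n : ℕ) (k : Fin (M.K n)) :
    AEStronglyMeasurable[MeasurableSpace.comap (M.W 0) inferInstance]
      (fun ω => M.instr n k (M.obs 0 ω)) P :=
  ((measurable_whiten (M.measurable_b _) k).comp
    (comap_measurable (M.W 0))).stronglyMeasurable.aestronglyMeasurable

theorem integral_instr_sq (n : ℕ) (k : Fin (M.K n)) : ∫ s, M.instr n k s ^ 2 ∂M.lawObs = 1 := by
  simp_rw [sq]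
  rw [← inner_toLp_toLp (M.memLp_instr n k) (M.memLp_instr n k), real_inner_self_eq_norm_sq,
    (M.orthonormal_instr n).1, one_pow]

variable [IsProbabilityMeasure P]

theorem integral_moment_noise (h : MemLp (M.moment n M.noise) 2 M.lawObs) :
    ∫ s, M.moment n M.noise s ∂M.lawObs = 0 := by
  rw [integral_moment h]
  ext k
  have integrable : Integrable (fun s => M.instr n k s * M.noise s) M.lawObs :=
    (h.integrable one_le_two).eval_piLp k
  have integrable_obs : Integrable (fun ω => M.instr n k (M.obs 0 ω) *
      (M.Y 0 ω - M.h₀ (M.X 0 ω))) P := integrable.comp_measurable (M.measurable_obs 0)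
  calc ∫ s, M.instr n k s * M.noise s ∂M.lawObs
    _ = ∫ ω, M.instr n k (M.obs 0 ω) * (M.Y 0 ω - M.h₀ (M.X 0 ω)) ∂P :=
        integral_map (M.measurable_obs 0).aemeasurable integrable.1
    _ = ∫ ω, M.instr n k (M.obs 0 ω) * (P[fun ω => M.Y 0 ω - M.h₀ (M.X 0 ω) |
          MeasurableSpace.comap (M.W 0) inferInstance]) ω ∂P :=
        (integral_mul_condExp (M.sample.measurable_W 0).comap_le
          (aestronglyMeasurable_instr_obs n k) integrable_obs (M.sample.integrable_u 0)).symm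
    _ = 0 := by
        refine integral_eq_zero_of_ae ?_
        filter_upwards [M.sample.condExp_u 0] with ω hω
        rw [hω, Pi.zero_apply, mul_zero]

theorem integral_norm_moment_noise_sq_le (h : MemLp (M.moment n M.noise) 2 M.lawObs)
    (hu : MemLp (fun ω => M.Y 0 ω - M.h₀ (M.X 0 ω)) 2 P) {c : ℝ}
    (hc : P[fun ω => (M.Y 0 ω - M.h₀ (M.X 0 ω)) ^ 2 |
      MeasurableSpace.comap (M.W 0) inferInstance] ≤ᵐ[P] fun _ => c) :
    ∫ s, ‖M.moment n M.noise s‖ ^ 2 ∂M.lawObs ≤ M.K n * c := by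
  have integrable (k : Fin (M.K n)) :
      Integrable (fun s => M.instr n k s ^ 2 * M.noise s ^ 2) M.lawObs :=
    (h.eval_piLp k).integrable_sq.congr (.of_forall fun s => mul_pow _ _ _)
  have coordinate (k : Fin (M.K n)) :
      ∫ s, M.instr n k s ^ 2 * M.noise s ^ 2 ∂M.lawObs ≤ c := by
    have measurePreserving : MeasurePreserving (M.obs 0) P M.lawObs := ⟨M.measurable_obs 0, rfl⟩
    have instr_sq : Integrable (fun s => M.instr n k s ^ 2) M.lawObs :=
      (M.memLp_instr n k).integrable_sq
    rw [integral_map (M.measurable_obs 0).aemeasurable (integrable k).1]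
    refine (integral_mul_le_of_condExp_le (M.sample.measurable_W 0).comap_le
      ((aestronglyMeasurable_instr_obs n k).pow 2) (fun ω => sq_nonneg _)
      (measurePreserving.integrable_comp_of_integrable instr_sq)
      (measurePreserving.integrable_comp_of_integrable (integrable k))
      hu.integrable_sq hc).trans_eq ?_
    exact (congrArg (c * ·) ((integral_map (M.measurable_obs 0).aemeasurable instr_sq.1).symm.trans
      (integral_instr_sq n k))).trans (mul_one c)
  calc ∫ s, ‖M.moment n M.noise s‖ ^ 2 ∂M.lawObs
    _ = ∫ s, ∑ k, M.instr n k s ^ 2 * M.noise s ^ 2 ∂M.lawObs := by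
        simp_rw [EuclideanSpace.real_norm_sq_eq, moment, mul_pow]
    _ = ∑ k, ∫ s, M.instr n k s ^ 2 * M.noise s ^ 2 ∂M.lawObs :=
        integral_finsetSum _ fun k _ => integrable k
    _ ≤ ∑ _k : Fin (M.K n), c := Finset.sum_le_sum fun k _ => coordinate k
    _ = M.K n * c := by rw [Finset.sum_const, Finset.card_univ, Fintype.card_fin, nsmul_eq_mul]

theorem IsRegularAt.eLpNorm_weightedMoment_noise_le (h : M.IsRegularAt n)
    (hu : MemLp (fun ω => M.Y 0 ω - M.h₀ (M.X 0 ω)) 2 P) {σ C : ℝ}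
    (hσ : P[fun ω => (M.Y 0 ω - M.h₀ (M.X 0 ω)) ^ 2 |
      MeasurableSpace.comap (M.W 0) inferInstance] ≤ᵐ[P] fun _ => σ ^ 2)
    (hC : M.K n ≤ C * M.J n) :
    eLpNorm (M.weightedMoment n M.noise) 2 P ≤
      ENNReal.ofReal √(C * σ ^ 2) * (M.tau n * ENNReal.ofReal √(M.J n / n)) := by
  have memLp := memLp_moment h.zetaMax_ne_top (memLp_noise hu)
  have second_moment : ∫ s, ‖M.moment n M.noise s‖ ^ 2 ∂M.lawObs ≤ C * σ ^ 2 * M.J n :=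
    (integral_norm_moment_noise_sq_le memLp hu hσ).trans
      ((mul_le_mul_of_nonneg_right hC (sq_nonneg σ)).trans_eq (mul_right_comm _ _ _))
  calc eLpNorm (M.weightedMoment n M.noise) 2 P
    _ ≤ M.tau n * (ENNReal.ofReal (√n)⁻¹ * ENNReal.ofReal √(C * σ ^ 2 * M.J n)) := by
        refine (eLpNorm_weightedMoment_le h.pos memLp).trans ?_
        rw [integral_moment_noise memLp, enorm_zero, zero_add, eLpNorm_two_eq_ofReal_sqrt memLp]
        gcongr
    _ = ENNReal.ofReal √(C * σ ^ 2) * (M.tau n * ENNReal.ofReal √(M.J n / n)) := by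
        rw [Real.sqrt_mul' _ (M.J n).cast_nonneg, Real.sqrt_div (M.J n).cast_nonneg,
          ENNReal.ofReal_mul (Real.sqrt_nonneg _), div_eq_mul_inv,
          ENNReal.ofReal_mul (Real.sqrt_nonneg _)]
        ring

end Noise

end Setting

section BigOP

variable {Ω : Type*} [MeasurableSpace Ω] {P : Measure Ω} {Z Z' : ℕ → Ω → ℝ≥0∞} {a : ℕ → ℝ≥0∞}

theorem IsBigOP.of_lintegral_le (hZ : ∀ᶠ n in atTop, AEMeasurable (Z n) P) {C : ℝ≥0}
    (h : ∀ᶠ n in atTop, ∫⁻ ω, Z n ω ∂P ≤ C * a n) : IsBigOP P Z a := by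
  intro ε hε
  obtain ⟨δ, hδ, hδε⟩ := ENNReal.lt_iff_exists_nnreal_btwn.1 hε
  have hδ₀ : δ ≠ 0 := (ENNReal.coe_pos.1 hδ).ne'
  have hM : (C + 1) / δ ≠ 0 := div_ne_zero (pos_of_gt (lt_add_one C)).ne' hδ₀
  refine ⟨(C + 1) / δ, ?_⟩
  filter_upwards [hZ, h] with n hZn hn
  rcases eq_or_ne (a n) 0 with ha₀ | ha₀
  · have Z_eq_zero : Z n =ᵐ[P] 0 := by
      rw [← lintegral_eq_zero_iff' hZn]
      simpa only [ha₀, mul_zero, nonpos_iff_eq_zero] using hn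
    exact (measure_mono_null (fun ω hω => (zero_le.trans_lt hω).ne') Z_eq_zero).trans_le hε.le
  rcases eq_or_ne (a n) ⊤ with ha | ha
  · have empty : {ω | ((C + 1) / δ : ℝ≥0) * a n < Z n ω} = ∅ := by
      simp_rw [ha, ENNReal.mul_top (ENNReal.coe_ne_zero.2 hM), not_top_lt, Set.ofPred_false]
    rw [empty, measure_empty]
    exact hε.le
  have subset : {ω | ((C + 1) / δ : ℝ≥0) * a n < Z n ω} ⊆ {ω | ((C + 1) / δ : ℝ≥0) * a n ≤ Z n ω} :=
    Set.ofPred_subset_ofPred.2 fun _ => le_of_lt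
  refine (measure_mono subset).trans ((meas_ge_le_lintegral_div hZn
    (mul_ne_zero (ENNReal.coe_ne_zero.2 hM) ha₀) (ENNReal.mul_ne_top ENNReal.coe_ne_top ha)).trans
    (ENNReal.div_le_of_le_mul ?_))
  calc ∫⁻ ω, Z n ω ∂P
    _ ≤ C * a n := hn
    _ ≤ (δ * ((C + 1) / δ) : ℝ≥0) * a n := by
        gcongr
        rw [mul_div_cancel₀ _ hδ₀]
        exact le_self_add
    _ ≤ ε * (((C + 1) / δ : ℝ≥0) * a n) := by
        rw [ENNReal.coe_mul, mul_assoc]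
        gcongr

theorem IsBigOP.of_le_on (hZ : IsBigOP P Z a) {E : ℕ → Set Ω}
    (hE : Tendsto (fun n => P (E n)ᶜ) atTop (𝓝 0))
    (h : ∀ᶠ n in atTop, ∀ ω ∈ E n, Z' n ω ≤ Z n ω) : IsBigOP P Z' a := by
  intro ε hε
  obtain ⟨C, hC⟩ := hZ (ε / 2) (ENNReal.half_pos hε.ne')
  refine ⟨C, ?_⟩
  filter_upwards [hC, h, hE.eventually (ge_mem_nhds (ENNReal.half_pos hε.ne'))] with n hCn hn hEn
  calc P {ω | C * a n < Z' n ω}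
    _ ≤ P ({ω | C * a n < Z n ω} ∪ (E n)ᶜ) :=
        measure_mono fun ω hω => (em (ω ∈ E n)).imp (fun hωE => hω.trans_le (hn ω hωE)) id
    _ ≤ ε / 2 + ε / 2 := (measure_union_le _ _).trans (add_le_add hCn hEn)
    _ = ε := ENNReal.add_halves ε

end BigOP

namespace Setting

variable {Ω : Type*} [MeasurableSpace Ω] {P : Measure Ω} [IsProbabilityMeasure P] {d dw : ℕ}
  (M : Setting P d dw)

theorem isBigOP_eLpNorm_sieveFit_sub
    (hgap : Tendsto (fun n => M.tau n * projectionGap M.T (M.sieveX n) (M.sieveW n)) atTop (𝓝 0))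
    (hrate : Tendsto (fun n : ℕ => M.tau n * M.zetaMax n *
      ENNReal.ofReal √(Real.log (M.J n) / n)) atTop (𝓝 0))
    {Z : ℕ → Ω → ℝ} {q : ℕ → Observation d dw → ℝ} (hq : ∀ n, MemLp (q n) 2 M.lawObs)
    (hZ : ∀ n i ω, Z i ω =
      series (M.ψ (M.J n)) (M.projCoef n) (M.X i ω) + q n (M.obs i ω))
    {C : ℝ≥0} {a : ℕ → ℝ≥0∞} (ha : ∀ n, ‖M.approxError n‖ₑ ≤ a n)
    (hC : ∀ᶠ n in atTop, eLpNorm (M.weightedMoment n (q n)) 2 P ≤ C * a n) :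
    IsBigOP P (fun n ω => eLpNorm (fun x => sieveFit M.ginv n (M.ψ (M.J n)) (M.b (M.K n)) Z
      M.X M.W ω x - M.h₀ x) 2 M.lawX) a := by
  have regular := M.eventually_isRegularAt hgap hrate
  have measurable : ∀ᶠ n in atTop, AEMeasurable
      (fun ω => 4 * ‖M.weightedMoment n (q n) ω‖ₑ + ‖M.approxError n‖ₑ) P := by
    filter_upwards [regular] with n hreg
    exact ((memLp_weightedMoment (memLp_moment hreg.zetaMax_ne_top (hq n))).1.enorm.const_mul
      4).add_const _
  refine (IsBigOP.of_lintegral_le (C := 4 * C + 1) measurable ?_).of_le_on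
    (M.tendsto_measure_compl_goodEvent hgap hrate)
    (regular.mono fun n hreg ω hω => hreg.eLpNorm_sieveFit_sub_le hω fun i => hZ n i ω)
  filter_upwards [regular, hC] with n hreg hCn
  have memLp := memLp_weightedMoment (memLp_moment hreg.zetaMax_ne_top (hq n))
  calc ∫⁻ ω, (4 * ‖M.weightedMoment n (q n) ω‖ₑ + ‖M.approxError n‖ₑ) ∂P
    _ = 4 * eLpNorm (M.weightedMoment n (q n)) 1 P + ‖M.approxError n‖ₑ := by
        rw [lintegral_add_right _ measurable_const, lintegral_const_mul' _ _ ENNReal.ofNat_ne_top,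
          lintegral_const, measure_univ, mul_one, eLpNorm_one_eq_lintegral_enorm]
    _ ≤ 4 * (C * a n) + a n := by
        gcongr
        · exact (eLpNorm_le_eLpNorm_of_exponent_le one_le_two memLp.1).trans hCn
        · exact ha n
    _ = (4 * C + 1 : ℝ≥0) * a n := by
        push_cast
        ring

end Setting

theorem coe_mul_add_coe_mul_le (C D : ℝ≥0) (a b : ℝ≥0∞) :
    C * a + D * b ≤ (C + D : ℝ≥0) * (a + b) := by
  rw [ENNReal.coe_add, mul_add]
  gcongr
  · exact le_self_add
  · exact le_add_self

namespace Setting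

variable {Ω : Type*} [MeasurableSpace Ω] {P : Measure Ω} [IsProbabilityMeasure P] {d dw : ℕ}
  (M : Setting P d dw)

theorem eventually_eLpNorm_weightedMoment_noise_le
    (hgap : Tendsto (fun n => M.tau n * projectionGap M.T (M.sieveX n) (M.sieveW n)) atTop (𝓝 0))
    (hrate : Tendsto (fun n : ℕ => M.tau n * M.zetaMax n *
      ENNReal.ofReal √(Real.log (M.J n) / n)) atTop (𝓝 0))
    (hvar : BoundedCondVariance P M.Y M.X M.W M.h₀) :
    ∃ C : ℝ≥0, ∀ᶠ n in atTop, eLpNorm (M.weightedMoment n M.noise) 2 P ≤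
      C * (M.tau n * ENNReal.ofReal √(M.J n / n)) := by
  obtain ⟨σ, hσ⟩ := hvar
  obtain ⟨C, -, hC⟩ := M.K_isBigO.exists_nonneg
  refine ⟨(√(C * σ ^ 2)).toNNReal, ?_⟩
  filter_upwards [M.eventually_isRegularAt hgap hrate, hC.bound] with n hreg hK
  rw [Real.norm_natCast, Real.norm_natCast] at hK
  exact hreg.eLpNorm_weightedMoment_noise_le (hσ 0).1 (hσ 0).2 hK

theorem IsRegularAt.eLpNorm_weightedMoment_add_le {M : Setting P d dw} {n : ℕ}
    (h : M.IsRegularAt n) {q q' : Observation d dw → ℝ} (hq : MemLp q 2 M.lawObs)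
    (hq' : MemLp q' 2 M.lawObs) :
    eLpNorm (M.weightedMoment n (q + q')) 2 P ≤
      eLpNorm (M.weightedMoment n q) 2 P + eLpNorm (M.weightedMoment n q') 2 P := by
  rw [funext (M.weightedMoment_add n q q')]
  exact eLpNorm_add_le (memLp_weightedMoment (memLp_moment h.zetaMax_ne_top hq)).1
    (memLp_weightedMoment (memLp_moment h.zetaMax_ne_top hq')).1 one_le_two

theorem isBigOP_eLpNorm_hTilde_sub
    (hgap : Tendsto (fun n => M.tau n * projectionGap M.T (M.sieveX n) (M.sieveW n)) atTop (𝓝 0))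
    (hstab : ∃ C : ℝ≥0, ∀ n, M.tau n * ‖M.T (M.approxError n)‖ₑ ≤ C * ‖M.approxError n‖ₑ)
    (hrate : Tendsto (fun n : ℕ => M.tau n * M.zetaMax n *
      ENNReal.ofReal √(Real.log (M.J n) / n)) atTop (𝓝 0)) :
    IsBigOP P (fun n ω => eLpNorm (fun x => M.hTilde n ω x - M.h₀ x) 2 M.lawX)
      (fun n => ‖M.approxError n‖ₑ) := by
  obtain ⟨C, hC⟩ := hstab
  refine M.isBigOP_eLpNorm_sieveFit_sub hgap hrate M.memLp_resid_obs
    (fun n i ω => (add_sub_cancel _ _).symm) (C := C + 1) (fun n => le_rfl) ?_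
  filter_upwards [M.eventually_isRegularAt hgap hrate] with n hreg
  exact hreg.eLpNorm_weightedMoment_resid_le (hC n)

theorem isBigOP_eLpNorm_hHat_sub
    (hgap : Tendsto (fun n => M.tau n * projectionGap M.T (M.sieveX n) (M.sieveW n)) atTop (𝓝 0))
    (hstab : ∃ C : ℝ≥0, ∀ n, M.tau n * ‖M.T (M.approxError n)‖ₑ ≤ C * ‖M.approxError n‖ₑ)
    (hrate : Tendsto (fun n : ℕ => M.tau n * M.zetaMax n *
      ENNReal.ofReal √(Real.log (M.J n) / n)) atTop (𝓝 0))
    (hvar : BoundedCondVariance P M.Y M.X M.W M.h₀) :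
    IsBigOP P (fun n ω => eLpNorm (fun x => M.hHat n ω x - M.h₀ x) 2 M.lawX)
      (fun n => ‖M.approxError n‖ₑ + M.tau n * ENNReal.ofReal √(M.J n / n)) := by
  obtain ⟨C, hC⟩ := hstab
  obtain ⟨D, hD⟩ := M.eventually_eLpNorm_weightedMoment_noise_le hgap hrate hvar
  have memLp_noise : MemLp M.noise 2 M.lawObs := memLp_noise (hvar.choose_spec 0).1
  refine M.isBigOP_eLpNorm_sieveFit_sub hgap hrate
    (q := fun n => (fun s => M.resid n s.2.1) + M.noise) (C := C + 1 + D)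
    (fun n => (M.memLp_resid_obs n).add memLp_noise)
    (fun n i ω => by simp only [resid, noise, obs, Pi.add_apply]; ring) (fun n => le_self_add) ?_
  filter_upwards [M.eventually_isRegularAt hgap hrate, hD] with n hreg hDn
  exact ((hreg.eLpNorm_weightedMoment_add_le (M.memLp_resid_obs n) memLp_noise).trans
    (add_le_add (hreg.eLpNorm_weightedMoment_resid_le (hC n)) hDn)).trans
      (coe_mul_add_coe_mul_le _ _ _ _)

end Setting

end NPIV

end

theorem theorem2p3_general {Ω : Type*} [MeasurableSpace Ω] (P : Measure Ω) [IsProbabilityMeasure P]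
    {d dw : ℕ} (M : NPIV.Setting P d dw)
    (hgap : Tendsto (fun n => M.tau n * NPIV.projectionGap M.T (M.sieveX n) (M.sieveW n))
      atTop (𝓝 0))
    (hstab : ∃ C : ℝ≥0, ∀ n, M.tau n * ‖M.T (M.approxError n)‖ₑ ≤ C * ‖M.approxError n‖ₑ)
    (hrate : Tendsto (fun n : ℕ => M.tau n * M.zetaMax n *
      ENNReal.ofReal √(Real.log (M.J n) / n)) atTop (𝓝 0)) :
    NPIV.IsBigOP P (fun n ω => eLpNorm (fun x => M.hTilde n ω x - M.h₀ x) 2 M.lawX)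
      (fun n => ‖M.approxError n‖ₑ) ∧
    (NPIV.BoundedCondVariance P M.Y M.X M.W M.h₀ →
      NPIV.IsBigOP P (fun n ω => eLpNorm (fun x => M.hHat n ω x - M.h₀ x) 2 M.lawX)
        (fun n => ‖M.approxError n‖ₑ + M.tau n * ENNReal.ofReal √((M.J n : ℝ) / n))) :=
  ⟨M.isBigOP_eLpNorm_hTilde_sub hgap hstab hrate,
    M.isBigOP_eLpNorm_hHat_sub hgap hstab hrate⟩

theorem theorem2p3 {Ω : Type*} [MeasurableSpace Ω] (P : Measure Ω) [IsProbabilityMeasure P]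
    {d dw : ℕ} (M : NPIV.Setting P d dw)
    -- `T` is injective
    (hT : Function.Injective M.T)
    -- `sup_{h ∈ Ψ_J, ‖h‖ = 1} ‖(Π_K T - T) h‖ = o(1 / τ_J)`
    (hgap : Tendsto (fun n => M.tau n * NPIV.projectionGap M.T (M.sieveX n) (M.sieveW n))
      atTop (𝓝 0))
    -- `τ_J ‖T (h₀ - Π_J h₀)‖ ≤ const * ‖h₀ - Π_J h₀‖`
    (hstab : ∃ C : ℝ≥0, ∀ n, M.tau n * ‖M.T (M.approxError n)‖ₑ ≤ C * ‖M.approxError n‖ₑ)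
    -- `τ_J ζ √(log J / n) = o(1)`
    (hrate : Tendsto (fun n : ℕ => M.tau n * M.zetaMax n *
      ENNReal.ofReal √(Real.log (M.J n) / n)) atTop (𝓝 0)) :
    -- `‖h̃ - h₀‖ ≤ O_p(1) * ‖h₀ - Π_J h₀‖`
    NPIV.IsBigOP P (fun n ω => eLpNorm (fun x => M.hTilde n ω x - M.h₀ x) 2 M.lawX)
      (fun n => ‖M.approxError n‖ₑ) ∧
    -- `‖ĥ - h₀‖ = O_p(‖h₀ - Π_J h₀‖ + τ_J √(J / n))` under bounded conditional variance
    (NPIV.BoundedCondVariance P M.Y M.X M.W M.h₀ →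
      NPIV.IsBigOP P (fun n ω => eLpNorm (fun x => M.hHat n ω x - M.h₀ x) 2 M.lawX)
        (fun n => ‖M.approxError n‖ₑ + M.tau n * ENNReal.ofReal √((M.J n : ℝ) / n))) :=
  theorem2p3_general P M hgap hstab hrate
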